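/- Let $k,\ell\ge 1$ be integers, and let $\theta=\mathrm{rib}(k\,|\,\ell)$ be the anti-hook diagram, i.e. the skew diagram $\lambda/\mu$ with $\lambda=((k+1)^{\ell+1})$ and $\mu=(k^{\ell})$. Attach complex variables $\boldsymbol s$ to its boxes: $s_{00},s_{10},\dots,s_{k0}$ to the bottom row from left to right, and $s_{k0},s_{k1},\dots,s_{k\ell}$ to the rightmost column from bottom to top. Consider the series $$\zeta_\theta(\boldsymbol s)=\sum_{M}\ \prod_{(i,j)} m_{ij}^{-s_{ij}},$$ where $M=(m_{ij})$ runs over the semi-standard tableaux of shape $\theta$ with positive integer entries (weakly increasing along rows, strictly increasing down columns), i.e. $m_{00}\le m_{10}\le\cdots\le m_{k0}$ and $m_{k\ell}<\cdots<m_{k1}<m_{k0}$, and $$\zeta_{EZ,r}(s_1,\dots,s_r)=\sum_{1\le m_1<\cdots<m_r} m_1^{-s_1}\cdots m_r^{-s_r},\qquad \zeta^\star_{EZ,r}(s_1,\dots,s_r)=\sum_{1\le m_1\le\cdots\le m_r} m_1^{-s_1}\cdots m_r^{-s_r},$$ both equal to $1$ when $r=0$. The series $\zeta_\theta$ converges absolutely,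 to a function holomorphic at each such point, when $\operatorname{Re}s_{k0}>1$ and the other real parts are $\ge1$; likewise $\zeta_{EZ,r}$ and $\zeta^\star_{EZ,r}$ when $\operatorname{Re}s_r>1$ and $\operatorname{Re}s_j\ge1$ for $j<r$. All these functions have meromorphic continuations to the whole spaces $\mathbb C^{k+\ell+1}$ and $\mathbb C^r$ ($r\ge0$), and $$\zeta_\theta(\boldsymbol s)=\sum_{i=0}^{k}(-1)^{k-i}\,\zeta^\star_{EZ,i}(s_{00},s_{10},\dots,s_{i-1,0})\;\zeta_{EZ,\ell+k-i+1}(s_{k\ell},s_{k,\ell-1},\dots,s_{k0},s_{k-1,0},\dots,s_{i0}).$$ The identity holds between the series when all the variables have real part $>1$. It holds for the continuations on the whole space $\mathbb C^{k+\ell+1}$ as an identity of meromorphic functions; in particular it holds at every point at which all the functions occurring in it are holomorphic. -/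

import Mathlib

open Topology

noncomputable section

namespace SchurZeta

/-! Euler-Zagier multiple zeta-functions and their star variants, as series. -/

/-- The summation range `1 ≤ m₁ < ⋯ < m_r` of the Euler-Zagier series. -/
abbrev EZIndex (r : ℕ) : Type := {m : Fin r → ℕ+ // StrictMono m}

/-- The summation range `1 ≤ m₁ ≤ ⋯ ≤ m_r` of the star variant. -/
abbrev EZStarIndex (r : ℕ) : Type := {m : Fin r → ℕ+ // Monotone m}

/-- The term `m₁^{-s₁} ⋯ m_r^{-s_r}` of the Euler-Zagier series. -/
def ezTerm (r : ℕ) (s : Fin r → ℂ) (m : EZIndex r) : ℂ :=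
  ∏ j, ((m.1 j : ℕ) : ℂ) ^ (-s j)

/-- The term `m₁^{-s₁} ⋯ m_r^{-s_r}` of the star series. -/
def ezStarTerm (r : ℕ) (s : Fin r → ℂ) (m : EZStarIndex r) : ℂ :=
  ∏ j, ((m.1 j : ℕ) : ℂ) ^ (-s j)

/-- The Euler-Zagier series in `r` variables. -/
def zetaEZ (r : ℕ) (s : Fin r → ℂ) : ℂ := ∑' m, ezTerm r s m

/-- The star series in `r` variables; for `r = 0` its single term is the empty product `1`. -/
def zetaEZStar (r : ℕ) (s : Fin r → ℂ) : ℂ := ∑' m, ezStarTerm r s m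

/-- The domain `Re s_j ≥ 1` for all `j` and `Re s_r > 1`, on which both series in `r` variables
converge absolutely. -/
def ezDomain (r : ℕ) : Set (Fin r → ℂ) :=
  {s | ∀ j : Fin r, 1 ≤ (s j).re ∧ ((j : ℕ) + 1 = r → 1 < (s j).re)}

/-! Skew diagrams and Schur multiple zeta-functions. A box is a pair (row, column), rows are
counted downwards and columns to the right, both from `0`, as in `YoungDiagram`. -/

/-- The boxes of the skew diagram `lam / mu`. -/
def skewBoxes (lam mu : YoungDiagram) : Finset (ℕ × ℕ) := lam.cells \ mu.cells

/-- Semi-standard tableaux with positive integer entries on a set of boxes: weakly increasing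
along rows and strictly increasing down columns. -/
def SSYT (θ : Finset (ℕ × ℕ)) : Type :=
  {M : θ → ℕ+ //
    (∀ a b : θ, a.1.1 = b.1.1 → a.1.2 ≤ b.1.2 → M a ≤ M b) ∧
    (∀ a b : θ, a.1.2 = b.1.2 → a.1.1 < b.1.1 → M a < M b)}

/-- The term `M^{-s} = ∏ m_{ij}^{-s_{ij}}`. -/
def schurTerm (θ : Finset (ℕ × ℕ)) (s : θ → ℂ) (M : SSYT θ) : ℂ :=
  ∏ a, ((M.1 a : ℕ) : ℂ) ^ (-s a)

/-- The Schur multiple zeta series of a set of boxes. -/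
def zetaSchur (θ : Finset (ℕ × ℕ)) (s : θ → ℂ) : ℂ := ∑' M, schurTerm θ s M

/-- A corner: neither the box below nor the box to the right belongs to the diagram. -/
def IsCorner (θ : Finset (ℕ × ℕ)) (a : θ) : Prop :=
  (a.1.1 + 1, a.1.2) ∉ θ ∧ (a.1.1, a.1.2 + 1) ∉ θ

/-- The domain `W_θ`: `Re s_a ≥ 1` at all boxes, and `Re s_a > 1` at the corners. -/
def schurDomain (θ : Finset (ℕ × ℕ)) : Set (θ → ℂ) :=
  {s | ∀ a : θ, 1 ≤ (s a).re ∧ (IsCorner θ a → 1 < (s a).re)}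

/-- The rectangular Young diagram with `a` rows of length `b`. -/
def rect (a b : ℕ) : YoungDiagram where
  cells := Finset.range a ×ˢ Finset.range b
  isLowerSet := by
    rintro ⟨x, y⟩ ⟨x', y'⟩ h hx
    simp only [Finset.coe_product, Finset.coe_range, Set.mem_prod, Set.mem_Iio] at hx ⊢
    exact ⟨lt_of_le_of_lt h.1 hx.1, lt_of_le_of_lt h.2 hx.2⟩

/-- The anti-hook `rib(k | ℓ)`: `ℓ + 1` rows of length `k + 1`, minus `ℓ` rows of length `k`. -/
def rib (k ℓ : ℕ) : Finset (ℕ × ℕ) := skewBoxes (rect (ℓ + 1) (k + 1)) (rect ℓ k)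

/-- The box of the variable `s_{i0}`: column `i` of the bottom row. -/
def rowBox (k ℓ : ℕ) (i : Fin (k + 1)) : rib k ℓ :=
  ⟨(ℓ, i), by simp [rib, skewBoxes, rect, i.isLt]⟩

/-- The box of the variable `s_{kj}`: `j` rows above the bottom of the rightmost column. -/
def colBox (k ℓ : ℕ) (j : Fin (ℓ + 1)) : rib k ℓ :=
  ⟨(ℓ - j, k), by simp [rib, skewBoxes, rect]⟩

/-- The vector `(s_{00}, s_{10}, …, s_{i-1,0})`. -/
def starArgs (k ℓ : ℕ) (i : Fin (k + 1)) (s : rib k ℓ → ℂ) : Fin i → ℂ :=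
  fun a => s (rowBox k ℓ ⟨a, by omega⟩)

/-- The vector `(s_{kℓ}, s_{k,ℓ-1}, …, s_{k0}, s_{k-1,0}, …, s_{i0})` of length `ℓ + k - i + 1`:
the entry at position `a` is `s_{k,ℓ-a}` for `a ≤ ℓ` and `s_{k-(a-ℓ),0}` for `a > ℓ`. -/
def ezArgs (k ℓ : ℕ) (i : Fin (k + 1)) (s : rib k ℓ → ℂ) : Fin (ℓ + k - i + 1) → ℂ :=
  fun a => if (a : ℕ) ≤ ℓ then s (colBox k ℓ ⟨ℓ - a, by omega⟩)
    else s (rowBox k ℓ ⟨k - (a - ℓ), by omega⟩)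

/-! Meromorphic functions of several variables. -/

/-- `F` is meromorphic at `p`: near `p` it is a quotient `g / h` of holomorphic functions, where
`h` does not vanish identically near `p`. The value of `F` at zeros of `h` is immaterial. -/
def IsMeromorphicAt {ι : Type} [Fintype ι] (F : (ι → ℂ) → ℂ) (p : ι → ℂ) : Prop :=
  ∃ g h : (ι → ℂ) → ℂ, AnalyticAt ℂ g p ∧ AnalyticAt ℂ h p ∧
    (¬ ∀ᶠ x in 𝓝 p, h x = 0) ∧ ∀ᶠ x in 𝓝 p, h x ≠ 0 → F x = g x / h x

/-- `F` and `G` agree near `p` as meromorphic functions: off the zeros of a holomorphic `h` that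
does not vanish identically near `p`. -/
def MeromorphicEqAt {ι : Type} [Fintype ι] (F G : (ι → ℂ) → ℂ) (p : ι → ℂ) : Prop :=
  ∃ h : (ι → ℂ) → ℂ, AnalyticAt ℂ h p ∧
    (¬ ∀ᶠ x in 𝓝 p, h x = 0) ∧ ∀ᶠ x in 𝓝 p, h x ≠ 0 → F x = G x

/-- `F` is a meromorphic continuation to `ℂ^ι` of the series with terms `term s`, which is
considered for `s ∈ D`: on `D` the series converges absolutely to `F`, and `F` is holomorphic
at the points of `D`. -/
structure IsContinuation {ι α : Type} [Fintype ι] (term : (ι → ℂ) → α → ℂ)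
    (D : Set (ι → ℂ)) (F : (ι → ℂ) → ℂ) : Prop where
  meromorphic : ∀ p, IsMeromorphicAt F p
  holomorphic : AnalyticOnNhd ℂ F D
  summable : ∀ s ∈ D, Summable fun m => ‖term s m‖
  eq_tsum : ∀ s ∈ D, F s = ∑' m, term s m

end SchurZeta

end

open Topology

noncomputable section

namespace SchurZeta

/-! Osgood's lemma and sums of holomorphic functions of several variables. -/

/-! The identity of series is a telescoping argument. Read the anti-hook as one path, along the row
and then up the column. Let `x i` be the sum over tuples that rise weakly up to position `i` and
fall strictly from there on (`IsUpDown`), and `S i` the sum over tuples where the rise stops just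
before `i` and the step into `i` is unconstrained (`IsSplit`). Then `S i` factors as a star series
times an Euler-Zagier series. Comparing the entries at `i` and `i + 1` gives `S (i + 1) = x (i + 1)
+ x i`, and `S 0 = x 0`. The alternating sum of the `S i` therefore collapses to `x k`, the
anti-hook series (`zetaSchur_rib_eq`).

All the continuations come from one family, the chain sums with gaps 0 or 1. Summing `(n - d)^(1 -
s) - (n - d + 1)^(1 - s)` over `n ≥ M + d` gives `M^(1 - s)`. Expanding the summand in powers of `n`
yields a recursion (`sum_teleCoeff_mul_chainSum`): the chain sum at `s`, times `s 0 - 1`, is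
expressed through its shifts to the right, a remainder that converges on a larger domain, and a
chain sum of smaller depth. After multiplication by a product of reciprocal Gamma functions all
poles disappear, and induction on the depth and on the size of the domain gives an entire function
(`exists_entire_extension`).

Euler-Zagier and star series are chain sums read backwards. The anti-hook series is a finite sum of
chain sums, one for each linear extension of the order on the boxes, with ties broken by the box
labels (`exists_isContinuation_rib`).

The identity theorem for meromorphic functions (`meromorphicEqAt_of_eventuallyEq`) then carries the
identity from the region of convergence to the whole space. -/

open Complex Metric MeasureTheory in
/-- The Cauchy integral formula on a polydisc. -/
theorem torusIntegral_prod_sub_inv_mul {n : ℕ} {f : (Fin n → ℂ) → ℂ} {c w : Fin n → ℂ} {R : ℝ}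
    (hR : 0 < R) (hf : ContinuousOn f (closedBall c R))
    (hd : ∀ z ∈ closedBall c R, ∀ i,
      DifferentiableOn ℂ (fun u => f (Function.update z i u)) (ball (c i) R))
    (hw : w ∈ ball c R) :
    (∯ z in T(c, fun _ => R), (∏ i, (z i - w i)⁻¹) * f z) = (2 * Real.pi * I) ^ n * f w := by
  induction n with
  | zero =>
    rw [torusIntegral_dim0]
    simp [Subsingleton.elim c w]
  | succ n ih =>
    have hmem : ∀ {x : ℂ} {y : Fin n → ℂ}, x ∈ closedBall (c 0) R →
        y ∈ closedBall (Fin.tail c) R → (Fin.cons x y : Fin (n + 1) → ℂ) ∈ closedBall c R := by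
      intro x y hx hy
      rw [mem_closedBall, dist_pi_le_iff hR.le] at hy ⊢
      intro i
      refine Fin.cases ?_ (fun j => ?_) i
      · simpa using hx
      · simpa [Fin.tail] using hy j
    have hw0 : w 0 ∈ ball (c 0) R := by
      rw [mem_ball, dist_pi_lt_iff hR] at hw
      exact hw 0
    have hwt : Fin.tail w ∈ ball (Fin.tail c) R := by
      rw [mem_ball, dist_pi_lt_iff hR] at hw ⊢
      exact fun i => hw i.succ
    have htorus : ∀ θ : Fin (n + 1) → ℝ, torusMap c (fun _ => R) θ ∈ closedBall c R := by
      intro θ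
      rw [mem_closedBall, dist_pi_le_iff hR.le]
      intro i
      simp [torusMap, norm_exp_ofReal_mul_I, abs_of_pos hR]
    have hne : ∀ θ : Fin (n + 1) → ℝ, ∀ i, torusMap c (fun _ => R) θ i - w i ≠ 0 := by
      intro θ i h0
      rw [mem_ball, dist_pi_lt_iff hR] at hw
      have h1 := hw i
      rw [← sub_eq_zero.1 h0] at h1
      simp [torusMap, norm_exp_ofReal_mul_I, abs_of_pos hR] at h1
    have hcm : Continuous (torusMap c (fun _ => R)) := by
      unfold torusMap
      fun_prop
    have hint : TorusIntegrable (fun z : Fin (n + 1) → ℂ => (∏ i, (z i - w i)⁻¹) * f z) c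
        (fun _ => R) := by
      refine Continuous.integrableOn_Icc ?_
      refine Continuous.mul ?_ (hf.comp_continuous hcm htorus)
      refine continuous_finsetProd _ fun i _ => ?_
      exact Continuous.inv₀ (((continuous_apply i).comp hcm).sub continuous_const)
        fun θ => hne θ i
    rw [torusIntegral_succ hint]
    -- With the first variable frozen on its circle, the induction hypothesis evaluates the integral
    -- over the others; one-variable Cauchy finishes.
    have hinner : ∀ x ∈ sphere (c 0) R,
        (∯ y in T(c ∘ Fin.succ, (fun _ => R) ∘ Fin.succ),
          (∏ i, ((Fin.cons x y : Fin (n + 1) → ℂ) i - w i)⁻¹) * f (Fin.cons x y)) =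
        (x - w 0)⁻¹ • ((2 * Real.pi * I) ^ n * f (Fin.cons x (Fin.tail w))) := by
      intro x hx
      have hx' := sphere_subset_closedBall hx
      rw [← ih (f := fun y => f (Fin.cons x y)) (c := Fin.tail c) (w := Fin.tail w) ?_ ?_ hwt,
        smul_eq_mul, ← torusIntegral_const_mul]
      · congr 1
        ext y
        rw [Fin.prod_univ_succ]
        simp only [Fin.cons_zero, Fin.cons_succ, Fin.tail]
        ring
      · exact hf.comp (by fun_prop) fun y hy => hmem hx' hy
      · intro z hz i
        simpa [Fin.cons_update, Fin.tail] using hd _ (hmem hx' hz) i.succ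
    rw [circleIntegral.integral_congr hR.le hinner]
    have hdc : DiffContOnCl ℂ (fun x => (2 * Real.pi * I) ^ n * f (Fin.cons x (Fin.tail w)))
        (ball (c 0) R) := by
      refine ⟨?_, ?_⟩
      · have := hd _ (hmem (mem_closedBall_self hR.le) (ball_subset_closedBall hwt)) 0
        simp only [Fin.update_cons_zero] at this
        exact this.const_mul _
      · rw [closure_ball _ hR.ne']
        refine continuousOn_const.mul (hf.comp (by fun_prop) fun x hx => ?_)
        exact hmem hx (ball_subset_closedBall hwt)
    rw [hdc.circleIntegral_sub_inv_smul hw0, smul_eq_mul]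
    rw [show (Fin.cons (w 0) (Fin.tail w) : Fin (n + 1) → ℂ) = w from Fin.cons_self_tail w]
    ring

-- No power series is expanded by hand. The Cauchy kernel is viewed as a map from `z` into the
-- Banach algebra of continuous functions on the parameter cube. It is analytic because inversion is
-- analytic at units, and integration against the boundary values is a continuous linear functional.
open Complex Metric MeasureTheory in
theorem analyticAt_of_polydisc {n : ℕ} {f : (Fin n → ℂ) → ℂ} {c : Fin n → ℂ} {R : ℝ}
    (hR : 0 < R) (hf : ContinuousOn f (closedBall c R))
    (hd : ∀ z ∈ closedBall c R, ∀ i,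
      DifferentiableOn ℂ (fun u => f (Function.update z i u)) (ball (c i) R)) :
    AnalyticAt ℂ f c := by
  set X : Set (Fin n → ℝ) := Set.Icc 0 fun _ => 2 * Real.pi
  have hcm : Continuous (torusMap c (fun _ => R)) := by
    unfold torusMap
    fun_prop
  have htorus : ∀ θ : Fin n → ℝ, torusMap c (fun _ => R) θ ∈ closedBall c R := by
    intro θ
    rw [mem_closedBall, dist_pi_le_iff hR.le]
    intro i
    simp [torusMap, norm_exp_ofReal_mul_I, abs_of_pos hR]
  have hne : ∀ z ∈ ball c R, ∀ θ : Fin n → ℝ, ∀ i, torusMap c (fun _ => R) θ i - z i ≠ 0 := by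
    intro z hz θ i h0
    rw [mem_ball, dist_pi_lt_iff hR] at hz
    have h1 := hz i
    rw [← sub_eq_zero.1 h0] at h1
    simp [torusMap, norm_exp_ofReal_mul_I, abs_of_pos hR] at h1
  have : CompactSpace X := isCompact_iff_compactSpace.1 isCompact_Icc
  let φ : Fin n → C(X, ℂ) := fun i =>
    ⟨fun θ => torusMap c (fun _ => R) θ i, (continuous_apply i).comp (hcm.comp continuous_subtype_val)⟩
  let G : C(X, ℂ) :=
    ⟨fun θ => (∏ i, (R : ℂ) * exp ((θ : Fin n → ℝ) i * I) * I) * f (torusMap c (fun _ => R) θ), by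
      refine Continuous.mul (continuous_finsetProd _ fun i _ => ?_) ?_
      · have h : Continuous fun x : Fin n → ℝ => (R : ℂ) * exp (x i * I) * I := by fun_prop
        exact h.comp continuous_subtype_val
      exact hf.comp_continuous (hcm.comp continuous_subtype_val) fun θ => htorus θ⟩
  let μ : Measure X := Measure.comap Subtype.val volume
  have : IsFiniteMeasure μ := by
    refine ⟨?_⟩
    rw [show μ = Measure.comap Subtype.val volume from rfl,
      comap_subtype_coe_apply measurableSet_Icc]
    rw [Set.image_univ, Subtype.range_coe]
    exact isCompact_Icc.measure_lt_top
  have hintg : ∀ ψ : C(X, ℂ), Integrable (fun θ => ψ θ) μ := fun ψ =>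
    Integrable.of_bound ψ.continuous.aestronglyMeasurable ‖ψ‖
      (Filter.Eventually.of_forall fun θ => ψ.norm_coe_le_norm θ)
  let Λ : C(X, ℂ) →L[ℂ] ℂ := LinearMap.mkContinuous
    { toFun := fun ψ => ∫ θ, ψ θ ∂μ
      map_add' := fun a b => integral_add (hintg a) (hintg b)
      map_smul' := fun a b => integral_const_mul a _ } (μ.real Set.univ) (by
        intro ψ
        have := norm_integral_le_of_norm_le_const (μ := μ) (f := fun θ => ψ θ) (C := ‖ψ‖)
          (Filter.Eventually.of_forall fun θ => ψ.norm_coe_le_norm θ)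
        rw [mul_comm]
        exact this)
  let k : (Fin n → ℂ) → C(X, ℂ) := fun z =>
    ∏ i, Ring.inverse (φ i - algebraMap ℂ C(X, ℂ) (z i))
  have hunit : ∀ z ∈ ball c R, ∀ i, IsUnit (φ i - algebraMap ℂ C(X, ℂ) (z i)) := by
    intro z hz i
    rw [ContinuousMap.isUnit_iff_forall_ne_zero]
    intro θ
    exact hne z hz θ i
  have hk : AnalyticAt ℂ k c := by
    refine Finset.analyticAt_fun_prod _ fun i _ => ?_
    have h1 : AnalyticAt ℂ (fun z : Fin n → ℂ => φ i - algebraMap ℂ C(X, ℂ) (z i)) c := by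
      refine analyticAt_const.sub ?_
      exact ((Algebra.linearMap ℂ C(X, ℂ)).toContinuousLinearMap.comp
        (ContinuousLinearMap.proj (R := ℂ) (φ := fun _ : Fin n => ℂ) i)).analyticAt c
    have h2 := (hunit c (mem_ball_self hR) i)
    exact AnalyticAt.fun_comp (g := Ring.inverse) (h2.unit_spec ▸ analyticAt_inverse h2.unit) h1
  have hmain : AnalyticAt ℂ (fun z => ((2 * Real.pi * I) ^ n)⁻¹ * Λ (k z * G)) c := by
    refine analyticAt_const.mul ?_
    exact (Λ.analyticAt _).fun_comp (hk.mul analyticAt_const)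
  refine hmain.congr ?_
  filter_upwards [ball_mem_nhds c hR] with z hz
  have hpi : (2 * Real.pi * I : ℂ) ^ n ≠ 0 := pow_ne_zero _ two_pi_I_ne_zero
  rw [inv_mul_eq_iff_eq_mul₀ hpi, ← torusIntegral_prod_sub_inv_mul hR hf hd hz, torusIntegral,
    ← integral_subtype_comap measurableSet_Icc]
  refine integral_congr_ae (Filter.Eventually.of_forall fun θ => ?_)
  have hkz : k z θ = ∏ i, (torusMap c (fun _ => R) θ i - z i)⁻¹ := by
    rw [ContinuousMap.coe_prod, Finset.prod_apply]
    refine Finset.prod_congr rfl fun i _ => ?_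
    have h1 := congrArg (fun ψ : C(X, ℂ) => ψ θ) (Ring.mul_inverse_cancel _ (hunit z hz i))
    exact eq_inv_of_mul_eq_one_right h1
  change k z θ * G θ = _
  rw [hkz]
  change _ * ((∏ i, (R : ℂ) * exp ((θ : Fin n → ℝ) i * I) * I) * f (torusMap c (fun _ => R) θ)) = (_ : ℂ) * (_ * _)
  ring

open Metric in
/-- Osgood's lemma: a continuous function that is holomorphic in each variable is analytic. -/
theorem analyticOnNhd_of_separately {n : ℕ} {f : (Fin n → ℂ) → ℂ} {U : Set (Fin n → ℂ)}
    (hU : IsOpen U) (hf : ContinuousOn f U)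
    (hd : ∀ z ∈ U, ∀ i, DifferentiableAt ℂ (fun u => f (Function.update z i u)) (z i)) :
    AnalyticOnNhd ℂ f U := by
  intro c hc
  obtain ⟨R, hR, hRU⟩ := nhds_basis_closedBall.mem_iff.1 (hU.mem_nhds hc)
  refine analyticAt_of_polydisc hR (hf.mono hRU) fun z hz i u hu => ?_
  have hmem : Function.update z i u ∈ U := by
    refine hRU ?_
    rw [mem_closedBall, dist_pi_le_iff hR.le] at hz ⊢
    intro j
    rcases eq_or_ne j i with rfl | hj
    · simpa using (mem_ball.1 hu).le
    · simpa [hj] using hz j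
  have := hd _ hmem i
  simp only [Function.update_idem, Function.update_self] at this
  exact this.differentiableWithinAt

open Metric in
/-- A locally normally convergent series of holomorphic functions is holomorphic. -/
theorem analyticOnNhd_tsum {α : Type*} {n : ℕ} {F : α → (Fin n → ℂ) → ℂ} {U : Set (Fin n → ℂ)}
    (hU : IsOpen U) (hF : ∀ a, DifferentiableOn ℂ (F a) U)
    (hb : ∀ p ∈ U, ∃ V ∈ 𝓝 p, ∃ u : α → ℝ, Summable u ∧ ∀ a, ∀ z ∈ V, ‖F a z‖ ≤ u a) :
    AnalyticOnNhd ℂ (fun z => ∑' a, F a z) U := by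
  refine analyticOnNhd_of_separately hU ?_ ?_
  · intro p hp
    obtain ⟨V, hV, u, hu, hub⟩ := hb p hp
    have h1 : ContinuousOn (fun z => ∑' a, F a z) (V ∩ U) :=
      continuousOn_tsum (fun a => (hF a).continuousOn.mono Set.inter_subset_right) hu
        fun a z hz => hub a z hz.1
    have h2 : V ∩ U ∈ 𝓝 p := Filter.inter_mem hV (hU.mem_nhds hp)
    exact (h1.continuousAt h2).continuousWithinAt
  · intro z hz i
    obtain ⟨V, hV, u, hu, hub⟩ := hb z hz
    have hcont : Continuous fun w : ℂ => Function.update z i w :=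
      continuous_const.update i continuous_id
    have h2 : (fun w : ℂ => Function.update z i w) ⁻¹' (V ∩ U) ∈ 𝓝 (z i) := by
      refine hcont.continuousAt.preimage_mem_nhds ?_
      simpa using Filter.inter_mem hV (hU.mem_nhds hz)
    obtain ⟨W, hW, hWo, hzW⟩ := _root_.mem_nhds_iff.1 h2
    refine (Complex.differentiableOn_tsum_of_summable_norm hu ?_ hWo fun a w hw =>
      hub a _ (hW hw).1).differentiableAt (hWo.mem_nhds hzW)
    intro a
    refine (hF a).comp ?_ fun w hw => (hW hw).2
    exact fun w _ => (hasFDerivAt_update z w).differentiableAt.differentiableWithinAt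

/-! Taylor expansion of `(1 + y) ^ z` with a remainder that is uniform in `z`. -/

/-- The binomial coefficient `z (z - 1) ⋯ (z - j + 1) / j!`. -/
def binomCoeff : ℕ → ℂ → ℂ
  | 0, _ => 1
  | j + 1, z => z / (j + 1) * binomCoeff j (z - 1)

theorem differentiable_binomCoeff (j : ℕ) : Differentiable ℂ (binomCoeff j) := by
  induction j with
  | zero => exact differentiable_const _
  | succ j ih =>
    exact (differentiable_id.div_const _).mul (ih.comp (differentiable_id.sub_const _))

/-- The remainder of the binomial series of `(1 + y) ^ z` after `N` terms. -/
def binomRem (N : ℕ) (z : ℂ) (y : ℝ) : ℂ :=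
  (1 + y : ℂ) ^ z - ∑ j ∈ Finset.range N, binomCoeff j z * (y : ℂ) ^ j

/-- The recursive form of `binomCoeff` is chosen so that differentiation lowers the order of the
remainder and the exponent together; this drives the induction for the uniform bound. -/
theorem hasDerivAt_binomRem (N : ℕ) (z : ℂ) {y : ℝ} (hy : -1 < y) :
    HasDerivAt (binomRem (N + 1) z) (z * binomRem N (z - 1) y) y := by
  have h1 : HasDerivAt (fun y : ℝ => (1 + y : ℂ) ^ z) (z * (1 + y : ℂ) ^ (z - 1)) y := by
    have h : HasDerivAt (fun w : ℂ => (1 + w) ^ z) (z * (1 + (y : ℂ)) ^ (z - 1) * 1) (y : ℂ) := by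
      refine HasDerivAt.cpow_const ((hasDerivAt_id _).const_add _) ?_
      refine Or.inl ?_
      simp
      linarith
    simpa using h.comp_ofReal
  have h2 : HasDerivAt (fun y : ℝ => ∑ j ∈ Finset.range (N + 1), binomCoeff j z * (y : ℂ) ^ j)
      (∑ j ∈ Finset.range (N + 1), binomCoeff j z * (j * (y : ℂ) ^ (j - 1))) y := by
    refine HasDerivAt.fun_sum fun j _ => ?_
    refine HasDerivAt.const_mul _ ?_
    exact (hasDerivAt_pow j (y : ℂ)).comp_ofReal
  have h3 := h1.sub h2
  refine h3.congr_deriv ?_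
  rw [binomRem, mul_sub, Finset.sum_range_succ', Finset.mul_sum]
  simp only [Nat.cast_zero, zero_mul, mul_zero, add_zero]
  congr 1
  refine Finset.sum_congr rfl fun j _ => ?_
  have hj : (j + 1 : ℂ) ≠ 0 := by exact_mod_cast Nat.succ_ne_zero j
  simp only [binomCoeff, Nat.add_sub_cancel]
  push_cast
  field_simp

theorem binomRem_succ_zero (N : ℕ) (z : ℂ) : binomRem (N + 1) z 0 = 0 := by
  simp [binomRem, Finset.sum_range_succ', binomCoeff]

/-- Mean value inequality and induction on `N`. The radius must vary, because the derivative
involves the exponent `z - 1`. On `[-1/2, 1]` one has `|log (1 + y)| ≤ log 2`, which gives the base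
case. -/
theorem exists_norm_binomRem_le (N : ℕ) (R : ℝ) :
    ∃ C, 0 ≤ C ∧ ∀ z : ℂ, ‖z‖ ≤ R → ∀ y ∈ Set.Icc (-(1 / 2) : ℝ) 1,
      ‖binomRem N z y‖ ≤ C * |y| ^ N := by
  induction N generalizing R with
  | zero =>
    refine ⟨Real.exp (R * Real.log 2), (Real.exp_pos _).le, fun z hz y hy => ?_⟩
    have hy0 : 0 < 1 + y := by linarith [hy.1]
    have hR : 0 ≤ R := (norm_nonneg z).trans hz
    have h1 : ‖(1 + y : ℂ) ^ z‖ = (1 + y) ^ z.re := by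
      rw [← Complex.norm_cpow_eq_rpow_re_of_pos hy0]
      push_cast
      rfl
    simp only [binomRem, Finset.range_zero, Finset.sum_empty, sub_zero, pow_zero, mul_one]
    rw [h1, Real.rpow_def_of_pos hy0]
    refine Real.exp_le_exp.2 ?_
    have hlog : |Real.log (1 + y)| ≤ Real.log 2 := by
      rw [abs_le]
      refine ⟨?_, Real.log_le_log hy0 (by linarith [hy.2])⟩
      rw [← Real.log_inv]
      exact Real.log_le_log (by norm_num) (by linarith [hy.1])
    calc Real.log (1 + y) * z.re ≤ |Real.log (1 + y) * z.re| := le_abs_self _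
      _ = |z.re| * |Real.log (1 + y)| := by rw [abs_mul, mul_comm]
      _ ≤ R * Real.log 2 :=
        mul_le_mul ((Complex.abs_re_le_norm z).trans hz) hlog (abs_nonneg _) hR
  | succ N ih =>
    obtain ⟨C, hC, hCb⟩ := ih (R + 1)
    rcases lt_or_ge R 0 with hR | hR
    · exact ⟨0, le_rfl, fun z hz => absurd ((norm_nonneg z).trans hz) (not_le.2 hR)⟩
    refine ⟨R * C, mul_nonneg hR hC, fun z hz y hy => ?_⟩
    have hz1 : ‖z - 1‖ ≤ R + 1 := (norm_sub_le _ _).trans (by simpa using hz)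
    have h0 : (0 : ℝ) ∈ Set.Icc (-(1 / 2) : ℝ) 1 := by constructor <;> norm_num
    have hsub : Set.uIcc 0 y ⊆ Set.Icc (-(1 / 2) : ℝ) 1 := Set.uIcc_subset_Icc h0 hy
    have hb := (convex_uIcc (0 : ℝ) y).norm_image_sub_le_of_norm_hasDerivWithin_le
      (f := binomRem (N + 1) z) (f' := fun t => z * binomRem N (z - 1) t) (C := R * (C * |y| ^ N))
      (fun t ht => (hasDerivAt_binomRem N z (by linarith [(hsub ht).1])).hasDerivWithinAt)
      (fun t ht => by
        rw [norm_mul]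
        have ht' : |t| ≤ |y| := by simpa using Set.abs_sub_left_of_mem_uIcc ht
        refine mul_le_mul hz ((hCb _ hz1 t (hsub ht)).trans ?_) (norm_nonneg _) hR
        gcongr) Set.left_mem_uIcc Set.right_mem_uIcc
    rw [binomRem_succ_zero, sub_zero, sub_zero, Real.norm_eq_abs] at hb
    calc _ ≤ _ := hb
      _ = _ := by ring

/-! Tails of `∑ n ^ (-σ)` and telescoping series. -/

theorem hasSum_ite_add_le {E : Type*} [AddCommMonoid E] [TopologicalSpace E] {w : ℕ+ → E} {a : E}
    {M : ℕ+} {d : ℕ} {v : ℕ → E}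
    (hv : ∀ i (n : ℕ+), (n : ℕ) = M + d + i → w n = v i) (h : HasSum v a) :
    HasSum (fun n : ℕ+ => if (M : ℕ) + d ≤ n then w n else 0) a := by
  have hpos : ∀ i : ℕ, 0 < (M : ℕ) + d + i := fun i => by have := M.pos; omega
  let e : ℕ → ℕ+ := fun i => ⟨M + d + i, hpos i⟩
  have he : Function.Injective e := by
    intro i j hij
    have := congrArg PNat.val hij
    simp only [e, PNat.mk_coe] at this
    omega
  rw [← he.hasSum_iff]
  · convert h using 1
    ext i
    change (if (M : ℕ) + d ≤ e i then w (e i) else 0) = v i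
    rw [if_pos (show (M : ℕ) + d ≤ e i from Nat.le_add_right _ _), hv i _ rfl]
  · intro n hn
    rw [if_neg]
    intro hle
    exact hn ⟨n - (M + d), PNat.eq (by simp only [e, PNat.mk_coe]; omega)⟩

/-- From `log (1 + 1/x) ≥ 1/(x + 1)` follows `(1 + 1/x)^a ≥ 1 + a/(x + 1)`. The claim then reduces
to `1/x ≤ (2 + a)/(x + 1 + a)`, an equality at `x = 1`; hence the constant. -/
theorem rpow_le_telescope {a : ℝ} (ha : 0 < a) {x : ℝ} (hx : 1 ≤ x) :
    x ^ (-(a + 1)) ≤ (2 + a) / a * (x ^ (-a) - (x + 1) ^ (-a)) := by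
  have hx0 : 0 < x := by linarith
  have h1 : (x + 1) ^ (-a) = x ^ (-a) * (1 + 1 / x) ^ (-a) := by
    rw [← Real.mul_rpow hx0.le (by positivity)]
    congr 1
    field_simp
  have h2 : (1 + 1 / x) ^ (-a) ≤ (1 + a / (x + 1))⁻¹ := by
    have hp : 0 < 1 + 1 / x := by positivity
    have hl : 1 / (x + 1) ≤ Real.log (1 + 1 / x) := by
      refine le_trans (le_of_eq ?_) (Real.one_sub_inv_le_log_of_pos hp)
      field_simp
      ring
    rw [Real.rpow_neg hp.le]
    refine inv_anti₀ (by positivity) ?_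
    rw [Real.rpow_def_of_pos hp]
    refine le_trans ?_ (Real.add_one_le_exp _)
    have := mul_le_mul_of_nonneg_right hl ha.le
    rw [add_comm]
    refine add_le_add ((le_of_eq ?_).trans this) le_rfl
    ring
  have h3 : x ^ (-(a + 1)) = x ^ (-a) * x⁻¹ := by
    rw [neg_add, Real.rpow_add hx0, Real.rpow_neg_one]
  rw [h1, h3]
  have hxa : 0 < x ^ (-a) := Real.rpow_pos_of_pos hx0 _
  have h4 : x⁻¹ ≤ (2 + a) / a * (1 - (1 + a / (x + 1))⁻¹) := by
    have : (2 + a) / a * (1 - (1 + a / (x + 1))⁻¹) = (2 + a) / (x + 1 + a) := by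
      field_simp
      ring
    rw [this, inv_eq_one_div, div_le_div_iff₀ hx0 (by positivity)]
    nlinarith
  calc x ^ (-a) * x⁻¹ ≤ x ^ (-a) * ((2 + a) / a * (1 - (1 + a / (x + 1))⁻¹)) := by gcongr
    _ ≤ x ^ (-a) * ((2 + a) / a * (1 - (1 + 1 / x) ^ (-a))) := by gcongr
    _ = _ := by ring

theorem exists_tsum_tail_le {σ : ℝ} (hσ : 1 < σ) :
    ∃ C, 0 ≤ C ∧ ∀ M : ℕ+,
      Summable (fun n : ℕ+ => if (M : ℕ) ≤ n then (n : ℝ) ^ (-σ) else 0) ∧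
      ∑' n : ℕ+, (if (M : ℕ) ≤ n then (n : ℝ) ^ (-σ) else 0) ≤ C * (M : ℝ) ^ (1 - σ) := by
  obtain ⟨a, ha, rfl⟩ : ∃ a, 0 < a ∧ σ = a + 1 := ⟨σ - 1, by linarith, by ring⟩
  have hC : 0 ≤ (2 + a) / a := by positivity
  refine ⟨(2 + a) / a, hC, fun M => ?_⟩
  have htel : HasSum (fun i : ℕ => (2 + a) / a *
      (((M + i : ℕ) : ℝ) ^ (-a) - ((M + i : ℕ) + 1 : ℝ) ^ (-a))) ((2 + a) / a * (M : ℝ) ^ (-a)) := by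
    refine HasSum.mul_left _ ?_
    rw [hasSum_iff_tendsto_nat_of_nonneg]
    · have h1 : ∀ N : ℕ, ∑ i ∈ Finset.range N,
          (((M + i : ℕ) : ℝ) ^ (-a) - ((M + i : ℕ) + 1 : ℝ) ^ (-a)) =
          (M : ℝ) ^ (-a) - ((M + N : ℕ) : ℝ) ^ (-a) := by
        intro N
        have := Finset.sum_range_sub' (fun i : ℕ => ((M + i : ℕ) : ℝ) ^ (-a)) N
        simp only [add_zero] at this
        rw [← this]
        refine Finset.sum_congr rfl fun i _ => ?_
        push_cast
        ring_nf
      simp_rw [h1]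
      have h2 : Filter.Tendsto (fun N : ℕ => ((M + N : ℕ) : ℝ) ^ (-a)) Filter.atTop (𝓝 0) := by
        refine (tendsto_rpow_neg_atTop ha).comp (tendsto_natCast_atTop_atTop.comp ?_)
        exact Filter.tendsto_atTop_mono (fun n => Nat.le_add_left n M) Filter.tendsto_id
      simpa using h2.const_sub ((M : ℝ) ^ (-a))
    · intro i
      have hp : (0 : ℝ) < ((M + i : ℕ) : ℝ) := by
        have := M.pos
        exact_mod_cast (by omega)
      refine sub_nonneg.2 (Real.rpow_le_rpow_of_nonpos hp (by linarith) (by linarith))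
  have hs := hasSum_ite_add_le (M := M) (d := 0) (w := fun n : ℕ+ => (2 + a) / a *
      ((n : ℝ) ^ (-a) - ((n : ℝ) + 1) ^ (-a))) (fun i n hn => by
        rw [add_zero] at hn
        simp [hn]) htel
  simp only [add_zero] at hs
  have hle : ∀ n : ℕ+, (if (M : ℕ) ≤ n then (n : ℝ) ^ (-(a + 1)) else 0) ≤
      if (M : ℕ) ≤ n then (2 + a) / a * ((n : ℝ) ^ (-a) - ((n : ℝ) + 1) ^ (-a)) else 0 := by
    intro n
    split_ifs
    · exact rpow_le_telescope ha (by exact_mod_cast n.pos)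
    · exact le_rfl
  have hsum : Summable (fun n : ℕ+ => if (M : ℕ) ≤ n then (n : ℝ) ^ (-(a + 1)) else 0) :=
    Summable.of_nonneg_of_le (fun n => by positivity) hle hs.summable
  refine ⟨hsum, ?_⟩
  rw [show (1 - (a + 1)) = -a by ring, ← hs.tsum_eq]
  exact hsum.tsum_le_tsum hle hs.summable

/-! Sums over chains `m₀ ≥ m₁ + d₀`, `m₁ ≥ m₂ + d₁`, …, with the largest entry first. -/

/-- The first entry of a tuple, `1` for the empty tuple. -/
def topEntry : ∀ {r : ℕ}, (Fin r → ℕ+) → ℕ+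
  | 0, _ => 1
  | _ + 1, m => m 0

/-- Each entry exceeds the next one (or `1`, for the last entry) by at least the given gap. -/
def IsChain : ∀ {r : ℕ}, (Fin r → ℕ) → (Fin r → ℕ+) → Prop
  | 0, _, _ => True
  | _ + 1, d, m => (topEntry (Fin.tail m) : ℕ) + d 0 ≤ m 0 ∧ IsChain (Fin.tail d) (Fin.tail m)

/-- Add a number to the first entry of a tuple. -/
def addTop : ∀ {r : ℕ}, (Fin r → ℂ) → ℂ → Fin r → ℂ
  | 0, v, _ => v
  | _ + 1, v, c => Fin.cons (v 0 + c) (Fin.tail v)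

/-- The exponents that remain after `∑ n ^ (-s₀)` has been replaced by a power `M ^ (1 - s₀)`. -/
def reduce {r : ℕ} (s : Fin (r + 1) → ℂ) : Fin r → ℂ := addTop (Fin.tail s) (s 0 - 1)

/-- The domain of absolute convergence `Re (s₀ + ⋯ + s_i) > i + 1`. -/
def chainDomain : ∀ r : ℕ, Set (Fin r → ℂ)
  | 0 => Set.univ
  | r + 1 => {s | 1 < (s 0).re ∧ reduce s ∈ chainDomain r}

/-- The product of the `m_i ^ (-s_i)`. -/
def powProd {r : ℕ} (s : Fin r → ℂ) (m : Fin r → ℕ+) : ℂ := ∏ i, ((m i : ℕ) : ℂ) ^ (-s i)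

/-- The terms of a chain sum, extended by zero to all tuples. -/
def chainTerm {r : ℕ} (d : Fin r → ℕ) (s : Fin r → ℂ) : (Fin r → ℕ+) → ℂ :=
  Set.indicator {m | IsChain d m} (powProd s)

/-- The sum of `∏ m_i ^ (-s_i)` over all chains. -/
def chainSum {r : ℕ} (d : Fin r → ℕ) (s : Fin r → ℂ) : ℂ := ∑' m, chainTerm d s m

open Classical in
/-- The terms of a chain sum in which the power of the first entry is replaced by `w`. -/
def topTerm {r : ℕ} (d : Fin (r + 1) → ℕ) (w : ℕ+ → ℂ) (s : Fin r → ℂ) (m : Fin (r + 1) → ℕ+) : ℂ :=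
  if (topEntry (Fin.tail m) : ℕ) + d 0 ≤ m 0 then w (m 0) * chainTerm (Fin.tail d) s (Fin.tail m)
  else 0

/-! ### Shifts of the first variable and the domain of absolute convergence. -/

theorem addTop_add {r : ℕ} (v : Fin r → ℂ) (a b : ℂ) :
    addTop (addTop v a) b = addTop v (a + b) := by
  cases r with
  | zero => rfl
  | succ r => simp [addTop, add_assoc]

theorem addTop_zero {r : ℕ} (v : Fin r → ℂ) : addTop v 0 = v := by
  cases r with
  | zero => rfl
  | succ r => simp [addTop]

theorem reduce_addTop {r : ℕ} (s : Fin (r + 1) → ℂ) (c : ℂ) :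
    reduce (addTop s c) = addTop (reduce s) c := by
  simp only [reduce, addTop_add]
  simp only [addTop, Fin.tail_cons, Fin.cons_zero]
  congr 1
  ring

theorem differentiable_addTop {r : ℕ} :
    Differentiable ℂ fun p : (Fin r → ℂ) × ℂ => addTop p.1 p.2 := by
  cases r with
  | zero => exact differentiable_fst
  | succ r =>
    rw [differentiable_pi]
    intro i
    refine Fin.cases ?_ (fun j => ?_) i
    · simp only [addTop, Fin.cons_zero]
      fun_prop
    · simp only [addTop, Fin.cons_succ, Fin.tail]
      fun_prop

theorem differentiable_tail {r : ℕ} :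
    Differentiable ℂ fun s : Fin (r + 1) → ℂ => (Fin.tail s : Fin r → ℂ) := by
  rw [differentiable_pi]
  intro i
  simp only [Fin.tail]
  fun_prop

theorem differentiable_reduce {r : ℕ} :
    Differentiable ℂ fun s : Fin (r + 1) → ℂ => reduce s := by
  have h : Differentiable ℂ fun s : Fin (r + 1) → ℂ => (Fin.tail s, s 0 - 1) :=
    differentiable_tail.prodMk (by fun_prop)
  exact differentiable_addTop.comp h

theorem differentiable_addTop_const {r : ℕ} (c : ℂ) :
    Differentiable ℂ fun s : Fin r → ℂ => addTop s c := by
  have h : Differentiable ℂ fun s : Fin r → ℂ => (s, c) :=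
    differentiable_id.prodMk (differentiable_const _)
  exact differentiable_addTop.comp h

theorem isOpen_chainDomain (r : ℕ) : IsOpen (chainDomain r) := by
  induction r with
  | zero => exact isOpen_univ
  | succ r ih =>
    refine IsOpen.inter ?_ (ih.preimage differentiable_reduce.continuous)
    exact isOpen_lt continuous_const (Complex.continuous_re.comp (continuous_apply 0))

theorem reduce_convexCombination {r : ℕ} (x y : Fin (r + 1) → ℂ) {a b : ℝ} (hab : a + b = 1) :
    reduce (a • x + b • y) = a • reduce x + b • reduce y := by
  have h : (a : ℂ) + b = 1 := by exact_mod_cast hab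
  cases r with
  | zero => exact Subsingleton.elim _ _
  | succ r =>
    ext i
    refine Fin.cases ?_ (fun j => ?_) i
    · simp only [reduce, addTop, Fin.tail, Fin.cons_zero, Pi.add_apply, Pi.smul_apply,
        Complex.real_smul]
      linear_combination h
    · simp [reduce, addTop, Fin.tail]

theorem convex_chainDomain (r : ℕ) : Convex ℝ (chainDomain r) := by
  induction r with
  | zero => exact convex_univ
  | succ r ih =>
    intro x hx y hy a b ha hb hab
    refine ⟨?_, ?_⟩
    · have := (convex_Ioi (1 : ℝ)) hx.1 hy.1 ha hb hab
      simpa using this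
    · rw [reduce_convexCombination x y hab]
      exact ih hx.2 hy.2 ha hb hab

theorem addTop_mem_chainDomain {r : ℕ} {s : Fin r → ℂ} (hs : s ∈ chainDomain r) {c : ℂ}
    (hc : 0 ≤ c.re) : addTop s c ∈ chainDomain r := by
  induction r with
  | zero => trivial
  | succ r ih =>
    refine ⟨?_, ?_⟩
    · have := hs.1
      simp only [addTop, Fin.cons_zero, Complex.add_re]
      linarith
    · rw [reduce_addTop]
      exact ih hs.2

/-- Each of the partial sums defining the domain contains the first variable, so a shift of that
variable alone raises all of them. Hence the shifted domains cover the whole space. -/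
theorem eventually_addTop_mem_chainDomain {r : ℕ} (s : Fin r → ℂ) :
    ∀ᶠ j : ℕ in Filter.atTop, addTop s (j : ℂ) ∈ chainDomain r := by
  induction r with
  | zero => exact Filter.Eventually.of_forall fun _ => trivial
  | succ r ih =>
    filter_upwards [ih (reduce s), (tendsto_natCast_atTop_atTop (R := ℝ)).eventually_gt_atTop
      (1 - (s 0).re)] with j h1 h2
    refine ⟨?_, ?_⟩
    · simp only [addTop, Fin.cons_zero, Complex.add_re, Complex.natCast_re]
      linarith
    · rw [reduce_addTop]
      exact h1

theorem mem_chainDomain_of_one_le {r : ℕ} {s : Fin (r + 1) → ℂ} (h0 : 1 < (s 0).re)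
    (h : ∀ i, 1 ≤ (s i).re) : s ∈ chainDomain (r + 1) := by
  induction r with
  | zero => exact ⟨h0, trivial⟩
  | succ r ih =>
    refine ⟨h0, ih ?_ fun i => ?_⟩
    · have := h 1
      simp only [reduce, addTop, Fin.cons_zero, Fin.tail, Complex.add_re, Complex.sub_re,
        Complex.one_re, Fin.succ_zero_eq_one]
      linarith
    · refine Fin.cases ?_ (fun j => ?_) i
      · have := h 1
        simp only [reduce, addTop, Fin.cons_zero, Fin.tail, Complex.add_re, Complex.sub_re,
          Complex.one_re, Fin.succ_zero_eq_one]
        linarith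
      · simpa [reduce, addTop, Fin.tail] using h j.succ.succ

theorem pnat_cast_ne_zero (n : ℕ+) : ((n : ℕ) : ℂ) ≠ 0 := by exact_mod_cast n.ne_zero

theorem norm_pnat_cpow (n : ℕ+) (z : ℂ) : ‖((n : ℕ) : ℂ) ^ z‖ = (n : ℝ) ^ z.re := by
  have := Complex.norm_cpow_eq_rpow_re_of_pos (x := (n : ℝ)) (by exact_mod_cast n.pos) z
  simpa using this

theorem powProd_succ {r : ℕ} (s : Fin (r + 1) → ℂ) (m : Fin (r + 1) → ℕ+) :
    powProd s m = ((m 0 : ℕ) : ℂ) ^ (-s 0) * powProd (Fin.tail s) (Fin.tail m) := by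
  rw [powProd, Fin.prod_univ_succ]
  rfl

theorem powProd_addTop {r : ℕ} (s : Fin r → ℂ) (c : ℂ) (m : Fin r → ℕ+) :
    powProd (addTop s c) m = ((topEntry m : ℕ) : ℂ) ^ (-c) * powProd s m := by
  cases r with
  | zero => simp [powProd, topEntry]
  | succ r =>
    rw [powProd_succ, powProd_succ]
    simp only [addTop, Fin.cons_zero, Fin.tail_cons, topEntry]
    rw [neg_add_rev, Complex.cpow_add _ _ (pnat_cast_ne_zero _), mul_assoc]

theorem chainTerm_addTop {r : ℕ} (d : Fin r → ℕ) (s : Fin r → ℂ) (c : ℂ) (m : Fin r → ℕ+) :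
    chainTerm d (addTop s c) m = ((topEntry m : ℕ) : ℂ) ^ (-c) * chainTerm d s m := by
  by_cases h : m ∈ {m | IsChain d m}
  · simp only [chainTerm, Set.indicator_of_mem h, powProd_addTop]
  · simp only [chainTerm, Set.indicator_of_notMem h, mul_zero]

theorem chainTerm_succ {r : ℕ} (d : Fin (r + 1) → ℕ) (s : Fin (r + 1) → ℂ) :
    chainTerm d s = topTerm d (fun n => ((n : ℕ) : ℂ) ^ (-s 0)) (Fin.tail s) := by
  ext m
  unfold chainTerm topTerm
  by_cases h1 : (topEntry (Fin.tail m) : ℕ) + d 0 ≤ m 0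
  · by_cases h2 : IsChain (Fin.tail d) (Fin.tail m)
    · rw [Set.indicator_of_mem (show m ∈ {m | IsChain d m} from ⟨h1, h2⟩), if_pos h1, chainTerm,
        Set.indicator_of_mem (show Fin.tail m ∈ {m | IsChain (Fin.tail d) m} from h2), powProd_succ]
    · rw [Set.indicator_of_notMem (fun h : m ∈ {m | IsChain d m} => h2 h.2), if_pos h1, chainTerm,
        Set.indicator_of_notMem (show Fin.tail m ∉ {m | IsChain (Fin.tail d) m} from h2), mul_zero]
  · rw [Set.indicator_of_notMem (fun h : m ∈ {m | IsChain d m} => h1 h.1), if_neg h1]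

theorem norm_chainTerm_le {r : ℕ} (d : Fin r → ℕ) {s t : Fin r → ℂ}
    (h : ∀ i, (t i).re ≤ (s i).re) (m : Fin r → ℕ+) : ‖chainTerm d s m‖ ≤ ‖chainTerm d t m‖ := by
  by_cases hm : m ∈ {m | IsChain d m}
  · simp only [chainTerm, Set.indicator_of_mem hm, powProd, norm_prod]
    refine Finset.prod_le_prod (fun i _ => norm_nonneg _) fun i _ => ?_
    rw [norm_pnat_cpow, norm_pnat_cpow]
    refine Real.rpow_le_rpow_of_exponent_le (by exact_mod_cast (m i).pos) ?_
    simpa using h i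
  · simp only [chainTerm, Set.indicator_of_notMem hm, norm_zero, le_refl]

/-- Split off the first entry of a tuple. -/
def tailTopEquiv (r : ℕ) : (Fin r → ℕ+) × ℕ+ ≃ (Fin (r + 1) → ℕ+) :=
  (Equiv.prodComm _ _).trans (Fin.consEquiv fun _ => ℕ+)

theorem topTerm_tailTopEquiv {r : ℕ} (d : Fin (r + 1) → ℕ) (w : ℕ+ → ℂ) (s : Fin r → ℂ)
    (p : (Fin r → ℕ+) × ℕ+) : topTerm d w s (tailTopEquiv r p) =
      (if (topEntry p.1 : ℕ) + d 0 ≤ p.2 then w p.2 else 0) * chainTerm (Fin.tail d) s p.1 := by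
  simp [topTerm, tailTopEquiv, Fin.consEquiv]

/-- Summing out the largest entry costs a factor `C * M ^ (1 - Re s₀)`, with `M` the next entry.
This power is absorbed into the exponent of `M`, which is what `reduce` records. -/
theorem summable_norm_chainTerm {r : ℕ} (d : Fin r → ℕ) {s : Fin r → ℂ} (hs : s ∈ chainDomain r) :
    Summable fun m => ‖chainTerm d s m‖ := by
  induction r with
  | zero => exact Summable.of_finite
  | succ r ih =>
    obtain ⟨C, hC, hb⟩ := exists_tsum_tail_le hs.1
    rw [← (tailTopEquiv r).summable_iff, chainTerm_succ]
    -- The majorant ignores the gap: it sums over all first entries from `M` on.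
    set g : (Fin r → ℕ+) × ℕ+ → ℝ := fun p =>
      (if (topEntry p.1 : ℕ) ≤ p.2 then (p.2 : ℝ) ^ (-(s 0).re) else 0) *
        ‖chainTerm (Fin.tail d) (Fin.tail s) p.1‖ with hg
    have hg0 : ∀ p, 0 ≤ g p := fun p => by positivity
    have hsg : Summable g := by
      rw [summable_prod_of_nonneg hg0]
      refine ⟨fun m => Summable.mul_right ‖chainTerm (Fin.tail d) (Fin.tail s) m‖
        (hb (topEntry m)).1, ?_⟩
      refine Summable.of_nonneg_of_le (fun m => tsum_nonneg fun n => hg0 (m, n)) (fun m => ?_)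
        ((ih (Fin.tail d) hs.2).mul_left C)
      have h1 := mul_le_mul_of_nonneg_right (hb (topEntry m)).2
        (norm_nonneg (chainTerm (Fin.tail d) (Fin.tail s) m))
      rw [← tsum_mul_right] at h1
      refine h1.trans (le_of_eq ?_)
      rw [reduce, chainTerm_addTop, norm_mul, norm_pnat_cpow, ← mul_assoc, Complex.neg_re,
        Complex.sub_re, Complex.one_re, neg_sub]
    refine Summable.of_nonneg_of_le (fun p => norm_nonneg _) (fun p => ?_) hsg
    simp only [hg]
    rw [Function.comp_apply, topTerm_tailTopEquiv, norm_mul]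
    refine mul_le_mul_of_nonneg_right ?_ (norm_nonneg _)
    split_ifs with h1 h2 h2
    · rw [norm_pnat_cpow, Complex.neg_re]
    · omega
    · rw [norm_zero]
      positivity
    · rw [norm_zero]

theorem norm_topTerm_le {r : ℕ} (d : Fin (r + 1) → ℕ) {w : ℕ+ → ℂ} {s : Fin (r + 1) → ℂ} {C : ℝ}
    (hw : ∀ n : ℕ+, 1 + d 0 ≤ (n : ℕ) → ‖w n‖ ≤ C * (n : ℝ) ^ (-(s 0).re)) (m : Fin (r + 1) → ℕ+) :
    ‖topTerm d w (Fin.tail s) m‖ ≤ C * ‖chainTerm d s m‖ := by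
  rw [chainTerm_succ]
  unfold topTerm
  split_ifs with h
  · rw [norm_mul, norm_mul, norm_pnat_cpow, ← mul_assoc, Complex.neg_re]
    refine mul_le_mul_of_nonneg_right (hw _ ?_) (norm_nonneg _)
    have := (topEntry (Fin.tail m)).pos
    omega
  · simp

theorem summable_norm_topTerm {r : ℕ} (d : Fin (r + 1) → ℕ) {w : ℕ+ → ℂ} {s : Fin (r + 1) → ℂ}
    {C : ℝ} (hs : s ∈ chainDomain (r + 1))
    (hw : ∀ n : ℕ+, 1 + d 0 ≤ (n : ℕ) → ‖w n‖ ≤ C * (n : ℝ) ^ (-(s 0).re)) :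
    Summable fun m => ‖topTerm d w (Fin.tail s) m‖ :=
  Summable.of_nonneg_of_le (fun _ => norm_nonneg _) (norm_topTerm_le d hw)
    ((summable_norm_chainTerm d hs).mul_left C)

/-- If the weights of the first entry telescope to a power of the second entry, the sum becomes a
chain sum in one variable less. -/
theorem tsum_topTerm {r : ℕ} (d : Fin (r + 1) → ℕ) {w : ℕ+ → ℂ} {s : Fin (r + 1) → ℂ}
    (hsum : Summable (topTerm d w (Fin.tail s)))
    (hw : ∀ M : ℕ+, ∑' n : ℕ+, (if (M : ℕ) + d 0 ≤ n then w n else 0) =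
      ((M : ℕ) : ℂ) ^ (1 - s 0)) :
    ∑' m, topTerm d w (Fin.tail s) m = chainSum (Fin.tail d) (reduce s) := by
  rw [← (tailTopEquiv r).tsum_eq]
  refine (Summable.tsum_prod ((tailTopEquiv r).summable_iff.2 hsum)).trans ?_
  refine tsum_congr fun m => ?_
  simp only [Function.comp_apply]
  simp only [topTerm_tailTopEquiv]
  rw [tsum_mul_right, hw, reduce, chainTerm_addTop, neg_sub]

/-! Analytic continuation of chain sums. -/

/-- The telescoping weight `(n - d) ^ (1 - s) - (n - d + 1) ^ (1 - s)`. -/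
def teleWeight (d : ℕ) (s : ℂ) (n : ℕ+) : ℂ :=
  ((n : ℕ) - d : ℂ) ^ (1 - s) - ((n : ℕ) - d + 1 : ℂ) ^ (1 - s)

/-- The coefficients of the expansion of `teleWeight` in powers of `n`. -/
def teleCoeff (d k : ℕ) (s : ℂ) : ℂ :=
  binomCoeff (k + 1) (1 - s) * ((-d) ^ (k + 1) - (1 - d) ^ (k + 1))

/-- The remainder of the expansion of `teleWeight` in powers of `n`. -/
def remWeight (d K : ℕ) (s : ℂ) (n : ℕ+) : ℂ :=
  teleWeight d s n - ∑ k ∈ Finset.range K, teleCoeff d k s * ((n : ℕ) : ℂ) ^ (-(s + k))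

/-- Every coefficient is divisible by `s - 1`, so solving the recursion for its leading term
introduces no new pole in the other coefficients. -/
theorem teleCoeff_eq (d k : ℕ) (s : ℂ) : teleCoeff d k s =
    (s - 1) * (binomCoeff k (-s) / (k + 1) * ((1 - d) ^ (k + 1) - (-d) ^ (k + 1))) := by
  simp only [teleCoeff, binomCoeff]
  rw [show 1 - s - 1 = -s by ring]
  ring

/-- Factor `n` out of both bases. The constant terms of the two binomial series cancel, so `K` terms
of the expansion correspond to remainders of order `K + 1`. -/
theorem remWeight_eq {d : ℕ} (K : ℕ) (s : ℂ) {n : ℕ+} (hn : 1 + d ≤ (n : ℕ)) :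
    remWeight d K s n = ((n : ℕ) : ℂ) ^ (1 - s) *
      (binomRem (K + 1) (1 - s) (-d / n) - binomRem (K + 1) (1 - s) ((1 - d) / n)) := by
  have hn0 : (0 : ℝ) < n := by exact_mod_cast n.pos
  have hn1 : (1 + d : ℝ) ≤ n := by exact_mod_cast hn
  have hnc : ((n : ℕ) : ℂ) ≠ 0 := pnat_cast_ne_zero n
  have hfac : ∀ y : ℝ, 0 ≤ 1 + y → ∀ x : ℂ, x = ((n : ℕ) : ℂ) * (1 + y) →
      x ^ (1 - s) = ((n : ℕ) : ℂ) ^ (1 - s) * (1 + y : ℂ) ^ (1 - s) := by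
    intro y hy x hx
    have := Complex.mul_cpow_ofReal_nonneg hn0.le hy (1 - s)
    rw [hx]
    push_cast at this
    exact this
  have h1 := hfac (-d / n) (by
    rw [neg_div, ← sub_eq_add_neg, sub_nonneg, div_le_one hn0]
    linarith) ((n : ℕ) - d) (by
    push_cast
    field_simp
    ring)
  have h2 := hfac ((1 - d) / n) (by
    rw [show (1 : ℝ) + (1 - d) / n = (n + (1 - d)) / n by field_simp]
    exact div_nonneg (by linarith) hn0.le) ((n : ℕ) - d + 1) (by
    push_cast
    field_simp
    ring)
  have hpow : ∀ k : ℕ, ((n : ℕ) : ℂ) ^ (-(s + k)) =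
      ((n : ℕ) : ℂ) ^ (1 - s) * (((n : ℕ) : ℂ)⁻¹) ^ (k + 1) := by
    intro k
    rw [inv_pow, ← Complex.cpow_natCast, ← Complex.cpow_neg, ← Complex.cpow_add _ _ hnc]
    congr 1
    push_cast
    ring
  rw [remWeight, teleWeight, h1, h2]
  simp only [binomRem, hpow]
  rw [Finset.sum_range_succ' _ K, Finset.sum_range_succ' _ K]
  have hsum : ∑ k ∈ Finset.range K, teleCoeff d k s *
      (((n : ℕ) : ℂ) ^ (1 - s) * (((n : ℕ) : ℂ)⁻¹) ^ (k + 1)) =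
      ((n : ℕ) : ℂ) ^ (1 - s) *
      (∑ k ∈ Finset.range K, binomCoeff (k + 1) (1 - s) * (((-d / n : ℝ)) : ℂ) ^ (k + 1) -
      ∑ k ∈ Finset.range K, binomCoeff (k + 1) (1 - s) * ((((1 - d) / n : ℝ)) : ℂ) ^ (k + 1)) := by
    rw [← Finset.sum_sub_distrib, Finset.mul_sum]
    refine Finset.sum_congr rfl fun k _ => ?_
    rw [teleCoeff]
    push_cast
    rw [div_pow, div_pow, inv_pow]
    ring
  rw [hsum]
  simp only [pow_zero]
  ring

theorem exists_norm_remWeight_le {d : ℕ} (hd : d ≤ 1) (K : ℕ) (R : ℝ) :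
    ∃ C, 0 ≤ C ∧ ∀ s : ℂ, ‖1 - s‖ ≤ R → ∀ n : ℕ+, 1 + d ≤ (n : ℕ) →
      ‖remWeight d K s n‖ ≤ C * (n : ℝ) ^ (-(s + K).re) := by
  obtain ⟨C, hC, hb⟩ := exists_norm_binomRem_le (K + 1) R
  refine ⟨2 * C, by positivity, fun s hs n hn => ?_⟩
  have hn0 : (0 : ℝ) < n := by exact_mod_cast n.pos
  have hn1 : (1 + d : ℝ) ≤ n := by exact_mod_cast hn
  have hbound : ∀ y ∈ Set.Icc (-(1 / 2) : ℝ) 1, |y| ≤ 1 / n →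
      ‖binomRem (K + 1) (1 - s) y‖ ≤ C * (1 / n) ^ (K + 1) := fun y hy hyn =>
    (hb _ hs y hy).trans (by gcongr)
  -- Here `d ≤ 1` matters: for `d = 0` the arguments are `0` and `1/n`; for `d = 1` they are `-1/n`
  -- and `0`, with `n ≥ 2`.
  have hmem : ∀ e : ℝ, (e = -d ∨ e = 1 - d) →
      e / n ∈ Set.Icc (-(1 / 2) : ℝ) 1 ∧ |e / n| ≤ 1 / n := by
    intro e he
    have he1 : -1 ≤ e ∧ e ≤ 1 ∧ -n ≤ 2 * e := by
      interval_cases d <;> rcases he with rfl | rfl <;> norm_num at hn1 ⊢ <;> linarith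
    obtain ⟨h1, h2, h3⟩ := he1
    refine ⟨⟨?_, ?_⟩, ?_⟩
    · rw [le_div_iff₀ hn0]
      linarith
    · rw [div_le_one hn0]
      have : (0 : ℝ) ≤ d := Nat.cast_nonneg d
      linarith
    · rw [abs_div, abs_of_pos hn0]
      gcongr
      exact abs_le.2 ⟨h1, h2⟩
  have h1 := hbound _ (hmem _ (Or.inl rfl)).1 (hmem _ (Or.inl rfl)).2
  have h2 := hbound _ (hmem _ (Or.inr rfl)).1 (hmem _ (Or.inr rfl)).2
  rw [remWeight_eq K s hn, norm_mul, norm_pnat_cpow]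
  have h3 : (n : ℝ) ^ (-(s + K).re) = (n : ℝ) ^ (1 - s).re * (1 / n) ^ (K + 1) := by
    rw [one_div, inv_pow, ← Real.rpow_natCast, ← Real.rpow_neg hn0.le, ← Real.rpow_add hn0]
    congr 1
    simp
    ring
  rw [h3]
  calc _ ≤ (n : ℝ) ^ (1 - s).re * (C * (1 / n) ^ (K + 1) + C * (1 / n) ^ (K + 1)) := by
        gcongr
        exact (norm_sub_le _ _).trans (add_le_add h1 h2)
    _ = _ := by ring

theorem differentiable_remWeight {d K : ℕ} {n : ℕ+} (hn : 1 + d ≤ (n : ℕ)) :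
    Differentiable ℂ fun s => remWeight d K s n := by
  have h1 : ((n : ℕ) - d : ℂ) ≠ 0 := by
    rw [sub_ne_zero]
    exact_mod_cast (by omega : (n : ℕ) ≠ d)
  have h2 : ((n : ℕ) - d + 1 : ℂ) ≠ 0 := by
    rw [sub_add_eq_add_sub, sub_ne_zero]
    exact_mod_cast (by omega : (n : ℕ) + 1 ≠ d)
  unfold remWeight teleWeight teleCoeff
  refine Differentiable.sub (Differentiable.sub ?_ ?_) (Differentiable.fun_sum fun k _ => ?_)
  · exact Differentiable.const_cpow (by fun_prop) (Or.inl h1)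
  · exact Differentiable.const_cpow (by fun_prop) (Or.inl h2)
  · refine Differentiable.mul (Differentiable.mul_const ?_ _) ?_
    · exact (differentiable_binomCoeff _).comp (by fun_prop : Differentiable ℂ fun s : ℂ => 1 - s)
    · exact Differentiable.const_cpow (by fun_prop) (Or.inl (pnat_cast_ne_zero n))

theorem tsum_teleWeight {d : ℕ} (hd : d ≤ 1) {s : ℂ} (hs : 1 < s.re) (M : ℕ+) :
    ∑' n : ℕ+, (if (M : ℕ) + d ≤ n then teleWeight d s n else 0) = ((M : ℕ) : ℂ) ^ (1 - s) := by
  set u : ℕ → ℂ := fun i => ((M + i : ℕ) : ℂ) ^ (1 - s) with hu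
  have hw : ∀ i (n : ℕ+), (n : ℕ) = M + d + i → teleWeight d s n = u i - u (i + 1) := by
    intro i n hn
    simp only [teleWeight, hu, hn]
    push_cast
    congr 2 <;> ring
  have hsum : Summable fun i => u i - u (i + 1) := by
    -- For `K = 0` the remainder is the weight itself, so it is `O(n ^ (-Re s))`.
    obtain ⟨C, hC, hb⟩ := exists_norm_remWeight_le hd 0 ‖1 - s‖
    have h1 : Summable fun n : ℕ => C * (n : ℝ) ^ (-s.re) :=
      (Real.summable_nat_rpow.2 (by linarith)).mul_left C
    have h2 := h1.comp_injective (add_right_injective ((M : ℕ) + d))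
    refine Summable.of_norm_bounded h2 fun i => ?_
    have hpos : 0 < (M : ℕ) + d + i := by have := M.pos; omega
    have h3 := hb s le_rfl ⟨M + d + i, hpos⟩ (by have := M.pos; simp only [PNat.mk_coe]; omega)
    rw [← hw i ⟨M + d + i, hpos⟩ rfl]
    simpa [remWeight] using h3
  have htend : Filter.Tendsto (fun N : ℕ => ∑ i ∈ Finset.range N, (u i - u (i + 1)))
      Filter.atTop (𝓝 (((M : ℕ) : ℂ) ^ (1 - s))) := by
    simp_rw [Finset.sum_range_sub']
    have h0 : u 0 = ((M : ℕ) : ℂ) ^ (1 - s) := by simp [hu]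
    have h2 : Filter.Tendsto u Filter.atTop (𝓝 0) := by
      rw [tendsto_zero_iff_norm_tendsto_zero]
      have h3 : ∀ N, ‖u N‖ = ((M + N : ℕ) : ℝ) ^ (-(s.re - 1)) := by
        intro N
        have hpos : 0 < (M : ℕ) + N := by have := M.pos; omega
        have := norm_pnat_cpow ⟨M + N, hpos⟩ (1 - s)
        rw [show -(s.re - 1) = (1 - s).re by simp]
        exact this
      simp_rw [h3]
      refine (tendsto_rpow_neg_atTop (by linarith)).comp (tendsto_natCast_atTop_atTop.comp ?_)
      exact Filter.tendsto_atTop_mono (fun n => Nat.le_add_left n M) Filter.tendsto_id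
    rw [← h0]
    simpa using h2.const_sub (u 0)
  have hhas : HasSum (fun i => u i - u (i + 1)) (((M : ℕ) : ℂ) ^ (1 - s)) := by
    have := hsum.hasSum
    rwa [tendsto_nhds_unique this.tendsto_sum_nat htend] at this
  exact (hasSum_ite_add_le hw hhas).tsum_eq

theorem summable_chainTerm {r : ℕ} (d : Fin r → ℕ) {s : Fin r → ℂ} (hs : s ∈ chainDomain r) :
    Summable (chainTerm d s) := (summable_norm_chainTerm d hs).of_norm

/-- The sum of `topTerm` for the remainder weight. -/
def remSum {r : ℕ} (d : Fin (r + 1) → ℕ) (K : ℕ) (s : Fin (r + 1) → ℂ) : ℂ :=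
  ∑' m, topTerm d (remWeight (d 0) K (s 0)) (Fin.tail s) m

/-- The telescoping weight is summed over chains in two ways: directly, which removes the first
entry, and after expansion in powers of that entry, each of which is a shift of its exponent. -/
theorem sum_teleCoeff_mul_chainSum {r : ℕ} {d : Fin (r + 1) → ℕ} (hd : d 0 ≤ 1) (K : ℕ)
    {s : Fin (r + 1) → ℂ} (hs : s ∈ chainDomain (r + 1)) :
    ∑ k ∈ Finset.range K, teleCoeff (d 0) k (s 0) * chainSum d (addTop s k) + remSum d K s =
      chainSum (Fin.tail d) (reduce s) := by
  have hk : ∀ K : ℕ, addTop s (K : ℂ) ∈ chainDomain (r + 1) := fun K =>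
    addTop_mem_chainDomain hs (by simp)
  have hrem : ∀ K, Summable (topTerm d (remWeight (d 0) K (s 0)) (Fin.tail s)) := by
    intro K
    obtain ⟨C, -, hb⟩ := exists_norm_remWeight_le hd K ‖1 - s 0‖
    exact (summable_norm_topTerm (s := addTop s K) d (hk K) (fun n hn => hb _ le_rfl n hn)).of_norm
  have htele : teleWeight (d 0) (s 0) = remWeight (d 0) 0 (s 0) := by
    ext n
    simp [remWeight]
  rw [← tsum_topTerm (w := teleWeight (d 0) (s 0)) d (htele ▸ hrem 0)
    (tsum_teleWeight hd hs.1), remSum]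
  simp only [chainSum, ← tsum_mul_left]
  rw [← Summable.tsum_finsetSum fun k _ => (summable_chainTerm d (hk k)).mul_left _,
    ← Summable.tsum_add (summable_sum fun k _ => (summable_chainTerm d (hk k)).mul_left _) (hrem K)]
  refine tsum_congr fun m => ?_
  simp only [chainTerm_succ, topTerm]
  split_ifs with h
  · simp only [addTop, Fin.cons_zero, Fin.tail_cons, remWeight, sub_mul, Finset.sum_mul]
    rw [Finset.sum_congr rfl fun k _ => (mul_assoc _ _ _).symm]
    ring
  · simp

theorem differentiable_chainTerm {r : ℕ} (d : Fin r → ℕ) (m : Fin r → ℕ+) :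
    Differentiable ℂ fun s => chainTerm d s m := by
  by_cases hm : m ∈ {m | IsChain d m}
  · simp only [chainTerm, Set.indicator_of_mem hm, powProd]
    refine Finset.induction_on Finset.univ (by simp) fun i t hi ih => ?_
    simp only [Finset.prod_insert hi]
    exact (Differentiable.const_cpow (by fun_prop) (Or.inl (pnat_cast_ne_zero _))).mul ih
  · simp only [chainTerm, Set.indicator_of_notMem hm]
    exact differentiable_const _

theorem analyticOnNhd_of_differentiableOn {n : ℕ} {f : (Fin n → ℂ) → ℂ} {U : Set (Fin n → ℂ)}
    (hU : IsOpen U) (hf : DifferentiableOn ℂ f U) : AnalyticOnNhd ℂ f U := by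
  refine analyticOnNhd_of_separately hU hf.continuousOn fun z hz i => ?_
  refine DifferentiableAt.comp (g := f) (z i) ?_ (hasFDerivAt_update z (z i)).differentiableAt
  rw [Function.update_eq_self]
  exact hf.differentiableAt (hU.mem_nhds hz)

theorem isOpen_shiftDomain (r : ℕ) (c : ℂ) : IsOpen {s | addTop s c ∈ chainDomain r} :=
  (isOpen_chainDomain r).preimage (differentiable_addTop_const c).continuous

theorem convex_shiftDomain (r : ℕ) (c : ℂ) : Convex ℝ {s | addTop s c ∈ chainDomain r} := by
  intro x hx y hy a b ha hb hab
  have h : (a : ℂ) + b = 1 := by exact_mod_cast hab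
  have heq : addTop (a • x + b • y) c = a • addTop x c + b • addTop y c := by
    cases r with
    | zero => exact Subsingleton.elim _ _
    | succ r =>
      ext i
      refine Fin.cases ?_ (fun j => ?_) i
      · simp only [addTop, Fin.cons_zero, Pi.add_apply, Pi.smul_apply, Complex.real_smul]
        linear_combination -c * h
      · simp [addTop, Fin.tail]
  rw [Set.mem_ofPred_eq, heq]
  exact convex_chainDomain r hx hy ha hb hab

/-- The remainder weight decays like the power shifted by `K`, so convergence is governed by the
shifted point, and the domain grows by `K` to the left. -/
theorem differentiableOn_remSum {r : ℕ} {d : Fin (r + 1) → ℕ} (hd : d 0 ≤ 1) (K : ℕ) :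
    DifferentiableOn ℂ (remSum d K) {s | addTop s (K : ℂ) ∈ chainDomain (r + 1)} := by
  have hopen := isOpen_shiftDomain (r + 1) (K : ℂ)
  refine (analyticOnNhd_tsum hopen (fun m => ?_) fun p hp => ?_).differentiableOn
  · refine Differentiable.differentiableOn ?_
    unfold topTerm
    split_ifs with h
    · refine Differentiable.mul ?_ ?_
      · have hn : 1 + d 0 ≤ (m 0 : ℕ) := by
          have := (topEntry (Fin.tail m)).pos
          omega
        exact (differentiable_remWeight hn).comp (differentiable_apply (0 : Fin (r + 1)))
      · exact (differentiable_chainTerm _ _).comp differentiable_tail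
    · exact differentiable_const _
  -- A point `q` slightly to the left of `p` in every coordinate still lies in the domain; its terms
  -- dominate those at all points near `p`.
  · have hcont : Filter.Tendsto (fun δ : ℝ => p - fun _ => (δ : ℂ)) (𝓝[>] 0) (𝓝 p) := by
      have h : Continuous fun δ : ℝ => p - fun _ => (δ : ℂ) := by fun_prop
      have := h.tendsto 0
      simp only [Complex.ofReal_zero] at this
      rw [show (p - fun _ => (0 : ℂ)) = p from sub_zero p] at this
      exact this.mono_left nhdsWithin_le_nhds
    obtain ⟨δ, hδp, hδ⟩ := ((hcont.eventually (hopen.mem_nhds hp)).and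
      self_mem_nhdsWithin).exists
    set q : Fin (r + 1) → ℂ := p - fun _ => (δ : ℂ) with hq
    obtain ⟨C, hC, hb⟩ := exists_norm_remWeight_le hd K (‖1 - p 0‖ + 1)
    refine ⟨{s | (∀ i, (q i).re < (s i).re) ∧ ‖1 - s 0‖ < ‖1 - p 0‖ + 1}, ?_,
      fun m => C * ‖chainTerm d (addTop q K) m‖, (summable_norm_chainTerm d hδp).mul_left C, ?_⟩
    · refine Filter.Eventually.and ?_ ?_
      · refine Filter.eventually_all.2 fun i => ?_
        refine (Complex.continuous_re.comp (continuous_apply i)).continuousAt.eventually_const_lt ?_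
        have : (0 : ℝ) < δ := hδ
        simpa [hq] using this
      · have h : Continuous fun s : Fin (r + 1) → ℂ => ‖1 - s 0‖ := by fun_prop
        exact h.continuousAt.eventually_lt_const (lt_add_one _)
    · rintro m s ⟨h1, h2⟩
      refine (norm_topTerm_le (s := addTop s K) d (fun n hn => hb _ h2.le n hn) m).trans ?_
      refine mul_le_mul_of_nonneg_left (norm_chainTerm_le d (fun i => ?_) m) hC
      refine Fin.cases ?_ (fun j => ?_) i
      · simpa [addTop] using (h1 0).le
      · simpa [addTop, Fin.tail] using (h1 j.succ).le

/-! ### Clearing denominators and enlarging the domain. -/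

/-- An entire function that cancels the poles of the chain sums. -/
def chainDenom : ∀ {r : ℕ}, (Fin r → ℂ) → ℂ
  | 0, _ => 1
  | _ + 1, s => (Complex.Gamma (s 0 - 1))⁻¹ * chainDenom (reduce s)

theorem differentiable_chainDenom (r : ℕ) :
    Differentiable ℂ (chainDenom : (Fin r → ℂ) → ℂ) := by
  induction r with
  | zero => exact differentiable_const _
  | succ r ih =>
    refine Differentiable.mul ?_ (ih.comp differentiable_reduce)
    exact Complex.differentiable_one_div_Gamma.comp
      (by fun_prop : Differentiable ℂ fun s : Fin (r + 1) → ℂ => s 0 - 1)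

theorem chainDenom_ne_zero {r : ℕ} {s : Fin r → ℂ} (hs : s ∈ chainDomain r) :
    chainDenom s ≠ 0 := by
  induction r with
  | zero => exact one_ne_zero
  | succ r ih =>
    refine mul_ne_zero (inv_ne_zero (Complex.Gamma_ne_zero_of_re_pos ?_)) (ih hs.2)
    have := hs.1
    simp only [Complex.sub_re, Complex.one_re]
    linarith

theorem exists_inv_Gamma_eq_mul (k : ℕ) : ∃ Q : ℂ → ℂ, Differentiable ℂ Q ∧
    ∀ x, (Complex.Gamma x)⁻¹ = Q x * (Complex.Gamma (x + k))⁻¹ := by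
  induction k with
  | zero => exact ⟨fun _ => 1, differentiable_const _, fun x => by simp⟩
  | succ k ih =>
    obtain ⟨Q, hQ, h⟩ := ih
    refine ⟨fun x => Q x * (x + k), hQ.mul (by fun_prop), fun x => ?_⟩
    rw [h, Complex.one_div_Gamma_eq_self_mul_one_div_Gamma_add_one (x + k)]
    push_cast
    rw [mul_assoc, add_assoc]

/-- The quotient is a product of factors from `1/Γ(x) = x (x + 1) ⋯ (x + k - 1) / Γ(x + k)`. It lets
the extended products at shifted points be used in the recursion for the denominator at `s`. -/
theorem exists_chainDenom_eq_mul (r k : ℕ) : ∃ P : (Fin r → ℂ) → ℂ, Differentiable ℂ P ∧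
    ∀ s, chainDenom s = P s * chainDenom (addTop s (k : ℂ)) := by
  induction r with
  | zero => exact ⟨fun _ => 1, differentiable_const _, fun s => by simp [addTop]⟩
  | succ r ih =>
    obtain ⟨P, hP, h⟩ := ih
    obtain ⟨Q, hQ, h'⟩ := exists_inv_Gamma_eq_mul k
    refine ⟨fun s => Q (s 0 - 1) * P (reduce s), ?_, fun s => ?_⟩
    · exact (hQ.comp (by fun_prop : Differentiable ℂ fun s : Fin (r + 1) → ℂ => s 0 - 1)).mul
        (hP.comp differentiable_reduce)
    · rw [chainDenom, chainDenom, h', h, reduce_addTop]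
      simp only [addTop, Fin.cons_zero]
      rw [show s 0 + k - 1 = s 0 - 1 + (k : ℂ) by ring]
      ring

theorem chainDenom_succ {r : ℕ} (s : Fin (r + 1) → ℂ) :
    chainDenom s = (s 0 - 1) * ((Complex.Gamma (s 0))⁻¹ * chainDenom (reduce s)) := by
  rw [chainDenom, Complex.one_div_Gamma_eq_self_mul_one_div_Gamma_add_one, sub_add_cancel, mul_assoc]

/-- The recursion is multiplied by `chainDenom s / (s 0 - 1)`, which is entire by `chainDenom_succ`,
and solved for the unshifted term. `G` supplies the shifted terms, so it is needed only to the right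
of the new domain. -/
theorem exists_extension_step {r : ℕ} {d : Fin (r + 1) → ℕ} (hd : d 0 ≤ 1)
    {g₀ : (Fin r → ℂ) → ℂ} (hg₀ : Differentiable ℂ g₀)
    (hg₀' : ∀ s ∈ chainDomain r, g₀ s = chainDenom s * chainSum (Fin.tail d) s) (N : ℕ)
    {G : (Fin (r + 1) → ℂ) → ℂ}
    (hG : ∀ k ∈ Finset.range N, DifferentiableOn ℂ (fun s => G (addTop s ((k + 1 : ℕ) : ℂ)))
      {s | addTop s ((N + 1 : ℕ) : ℂ) ∈ chainDomain (r + 1)})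
    (hG' : ∀ s ∈ chainDomain (r + 1), G s = chainDenom s * chainSum d s) :
    ∃ g : (Fin (r + 1) → ℂ) → ℂ,
      DifferentiableOn ℂ g {s | addTop s ((N + 1 : ℕ) : ℂ) ∈ chainDomain (r + 1)} ∧
      ∀ s ∈ chainDomain (r + 1), g s = chainDenom s * chainSum d s := by
  choose P hP hP' using fun k : ℕ => exists_chainDenom_eq_mul (r + 1) k
  set b : ℕ → ℂ → ℂ := fun k s =>
    binomCoeff k (-s) / (k + 1) * ((1 - d 0) ^ (k + 1) - (-d 0) ^ (k + 1))
  have hcoord : Differentiable ℂ fun s : Fin (r + 1) → ℂ => s 0 := by fun_prop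
  have hΓ : Differentiable ℂ fun s : Fin (r + 1) → ℂ => (Complex.Gamma (s 0))⁻¹ :=
    Complex.differentiable_one_div_Gamma.comp hcoord
  have hbd : ∀ k, Differentiable ℂ (b k) := fun k =>
    (((differentiable_binomCoeff k).comp differentiable_neg).div_const _).mul_const _
  refine ⟨fun s => (Complex.Gamma (s 0))⁻¹ * g₀ (reduce s) -
    ∑ k ∈ Finset.range N, b (k + 1) (s 0) * P (k + 1) s * G (addTop s ((k + 1 : ℕ) : ℂ)) -
    (Complex.Gamma (s 0))⁻¹ * chainDenom (reduce s) * remSum d (N + 1) s, ?_, fun s hs => ?_⟩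
  · refine DifferentiableOn.sub (DifferentiableOn.sub ?_ ?_) ?_
    · exact (hΓ.mul (hg₀.comp differentiable_reduce)).differentiableOn
    · refine DifferentiableOn.fun_sum fun k hk => ?_
      exact (((hbd _).comp hcoord).mul (hP _)).differentiableOn.mul (hG k hk)
    · refine DifferentiableOn.mul ?_ (differentiableOn_remSum hd (N + 1))
      exact (hΓ.mul ((differentiable_chainDenom r).comp differentiable_reduce)).differentiableOn
  · have hrel := sum_teleCoeff_mul_chainSum hd (N + 1) hs
    rw [Finset.sum_range_succ', Nat.cast_zero, addTop_zero] at hrel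
    have h0 : teleCoeff (d 0) 0 (s 0) = s 0 - 1 := by
      rw [teleCoeff_eq]
      simp [binomCoeff]
    have hk : ∀ k ∈ Finset.range N, b (k + 1) (s 0) * P (k + 1) s * G (addTop s ((k + 1 : ℕ) : ℂ)) =
        (Complex.Gamma (s 0))⁻¹ * chainDenom (reduce s) *
          (teleCoeff (d 0) (k + 1) (s 0) * chainSum d (addTop s ((k + 1 : ℕ) : ℂ))) := by
      intro k _
      rw [hG' _ (addTop_mem_chainDomain hs (by rw [Complex.natCast_re]; positivity)), teleCoeff_eq]
      have h1 := hP' (k + 1) s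
      rw [chainDenom_succ] at h1
      linear_combination -(b (k + 1) (s 0) * chainSum d (addTop s ((k + 1 : ℕ) : ℂ))) * h1
    simp only
    rw [Finset.sum_congr rfl hk, ← Finset.mul_sum, hg₀' _ hs.2, ← hrel, chainDenom_succ, h0]
    ring

/-- Every chain sum times its denominator extends to each shifted domain. -/
theorem exists_extension_shiftDomain {r : ℕ} {d : Fin (r + 1) → ℕ} (hd : d 0 ≤ 1)
    {g₀ : (Fin r → ℂ) → ℂ} (hg₀ : Differentiable ℂ g₀)
    (hg₀' : ∀ s ∈ chainDomain r, g₀ s = chainDenom s * chainSum (Fin.tail d) s) (j : ℕ) :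
    ∃ g : (Fin (r + 1) → ℂ) → ℂ,
      DifferentiableOn ℂ g {s | addTop s ((j + 1 : ℕ) : ℂ) ∈ chainDomain (r + 1)} ∧
      ∀ s ∈ chainDomain (r + 1), g s = chainDenom s * chainSum d s := by
  induction j with
  | zero =>
    -- No shifted term occurs when `N = 0`, so the series itself can serve as `G`.
    exact exists_extension_step hd hg₀ hg₀' 0 (G := fun s => chainDenom s * chainSum d s)
      (by simp) fun _ _ => rfl
  | succ j ih =>
    obtain ⟨G, hG, hG'⟩ := ih
    refine exists_extension_step hd hg₀ hg₀' (j + 1) (fun k _ => ?_) hG'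
    refine hG.comp (differentiable_addTop_const _).differentiableOn fun s hs => ?_
    change addTop (addTop s _) _ ∈ chainDomain (r + 1)
    have h1 : addTop (addTop s ((j + 1 + 1 : ℕ) : ℂ)) (k : ℂ) ∈ chainDomain (r + 1) :=
      addTop_mem_chainDomain hs (by simp)
    rw [addTop_add] at h1 ⊢
    convert h1 using 2
    push_cast
    ring

/-- Every chain sum times its denominator extends to an entire function. -/
theorem exists_entire_extension {r : ℕ} {d : Fin r → ℕ} (hd : ∀ i, d i ≤ 1) :
    ∃ g : (Fin r → ℂ) → ℂ, Differentiable ℂ g ∧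
      ∀ s ∈ chainDomain r, g s = chainDenom s * chainSum d s := by
  induction r with
  | zero =>
    refine ⟨fun s => chainDenom s * chainSum d s, ?_, fun _ _ => rfl⟩
    have h : (fun s => chainDenom s * chainSum d s) = fun _ => chainDenom (0 : Fin 0 → ℂ) * chainSum d 0 := by
      ext s
      rw [Subsingleton.elim s 0]
    rw [h]
    exact differentiable_const _
  | succ r ih =>
    obtain ⟨g₀, hg₀, hg₀'⟩ := ih (d := Fin.tail d) fun i => hd i.succ
    choose G hG hG' using exists_extension_shiftDomain (hd 0) hg₀ hg₀'
    set Ω : ℕ → Set (Fin (r + 1) → ℂ) := fun j => {s | addTop s ((j + 1 : ℕ) : ℂ) ∈ chainDomain (r + 1)}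
    have hΩo : ∀ j, IsOpen (Ω j) := fun j => isOpen_shiftDomain _ _
    have hΩ0 : ∀ j, chainDomain (r + 1) ⊆ Ω j := fun j s hs =>
      addTop_mem_chainDomain hs (by rw [Complex.natCast_re]; positivity)
    have hmono : ∀ i j, i ≤ j → Ω i ⊆ Ω j := by
      intro i j hij s hs
      have h1 : addTop (addTop s ((i + 1 : ℕ) : ℂ)) ((j - i : ℕ) : ℂ) ∈ chainDomain (r + 1) :=
        addTop_mem_chainDomain hs (by simp)
      rw [addTop_add] at h1
      change addTop s ((j + 1 : ℕ) : ℂ) ∈ chainDomain (r + 1)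
      convert h1 using 2
      rw [← Nat.cast_add]
      congr 1
      omega
    have hne : ∃ p, p ∈ chainDomain (r + 1) :=
      ⟨fun _ => 2, mem_chainDomain_of_one_le (by norm_num) fun _ => by norm_num⟩
    obtain ⟨p, hp⟩ := hne
    -- The shifted domains are convex, so extensions agreeing on the domain of convergence agree
    -- wherever both are defined, and can be glued.
    have hagree : ∀ i j, i ≤ j → Set.EqOn (G i) (G j) (Ω i) := by
      intro i j hij
      refine AnalyticOnNhd.eqOn_of_preconnected_of_eventuallyEq
        (analyticOnNhd_of_differentiableOn (hΩo i) (hG i))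
        (analyticOnNhd_of_differentiableOn (hΩo i) ((hG j).mono (hmono i j hij)))
        (convex_shiftDomain _ _).isPreconnected (hΩ0 i hp) ?_
      filter_upwards [(isOpen_chainDomain (r + 1)).mem_nhds hp] with s hs
      rw [hG' i s hs, hG' j s hs]
    have hcover : ∀ s, ∃ j, s ∈ Ω j := fun s =>
      ((Filter.tendsto_add_atTop_nat 1).eventually (eventually_addTop_mem_chainDomain s)).exists
    choose J hJ using hcover
    have hglue : ∀ j, ∀ s ∈ Ω j, G (J s) s = G j s := by
      intro j s hs
      rcases le_total (J s) j with h | h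
      · exact hagree _ _ h (hJ s)
      · exact (hagree _ _ h hs).symm
    refine ⟨fun s => G (J s) s, fun s => ?_, fun s hs => ?_⟩
    · refine ((hG (J s)).differentiableAt ((hΩo _).mem_nhds (hJ s))).congr_of_eventuallyEq ?_
      filter_upwards [(hΩo _).mem_nhds (hJ s)] with t ht
      exact hglue _ t ht
    · exact hG' _ s hs

/-! Meromorphic functions of several variables. -/

section Meromorphic

variable {ι κ : Type} [Fintype ι] [Fintype κ]

theorem not_eventually_eq_zero_of_mem_ball {h : (ι → ℂ) → ℂ} {p q : ι → ℂ} {R : ℝ}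
    (hh : AnalyticOnNhd ℂ h (Metric.ball p R)) (hp : ¬ ∀ᶠ x in 𝓝 p, h x = 0)
    (hq : q ∈ Metric.ball p R) : ¬ ∀ᶠ x in 𝓝 q, h x = 0 := by
  intro h0
  have hR : 0 < R := dist_nonneg.trans_lt (Metric.mem_ball.1 hq)
  have := hh.eqOn_zero_of_preconnected_of_eventuallyEq_zero (convex_ball p R).isPreconnected hq h0
  refine hp ?_
  filter_upwards [Metric.ball_mem_nhds p hR] with x hx
  exact this hx

theorem not_eventually_mul_eq_zero {h₁ h₂ : (ι → ℂ) → ℂ} {p : ι → ℂ} (h₁a : AnalyticAt ℂ h₁ p)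
    (h₂a : AnalyticAt ℂ h₂ p) (h₁0 : ¬ ∀ᶠ x in 𝓝 p, h₁ x = 0) (h₂0 : ¬ ∀ᶠ x in 𝓝 p, h₂ x = 0) :
    ¬ ∀ᶠ x in 𝓝 p, h₁ x * h₂ x = 0 := by
  intro h0
  obtain ⟨R, hR, hB⟩ := Metric.eventually_nhds_iff_ball.1
    (h0.and (h₁a.eventually_analyticAt.and h₂a.eventually_analyticAt))
  have hex : ∃ x ∈ Metric.ball p R, h₁ x ≠ 0 := by
    by_contra! hcon
    exact h₁0 (Filter.mem_of_superset (Metric.ball_mem_nhds p hR) hcon)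
  obtain ⟨x, hx, hx0⟩ := hex
  refine not_eventually_eq_zero_of_mem_ball (fun y hy => (hB y hy).2.2) h₂0 hx ?_
  filter_upwards [Metric.isOpen_ball.mem_nhds hx,
    (hB x hx).2.1.continuousAt.eventually_ne hx0] with y hy hy0
  exact (mul_eq_zero.1 (hB y hy).1).resolve_left hy0

theorem AnalyticAt.isMeromorphicAt {F : (ι → ℂ) → ℂ} {p : ι → ℂ} (hF : AnalyticAt ℂ F p) :
    IsMeromorphicAt F p := by
  refine ⟨F, fun _ => 1, hF, analyticAt_const, ?_, Filter.Eventually.of_forall fun x _ => by simp⟩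
  intro h
  exact one_ne_zero h.self_of_nhds

theorem IsMeromorphicAt.add {F G : (ι → ℂ) → ℂ} {p : ι → ℂ} (hF : IsMeromorphicAt F p)
    (hG : IsMeromorphicAt G p) : IsMeromorphicAt (fun x => F x + G x) p := by
  obtain ⟨g₁, h₁, hg₁, hh₁, h₁0, h₁F⟩ := hF
  obtain ⟨g₂, h₂, hg₂, hh₂, h₂0, h₂G⟩ := hG
  refine ⟨fun x => g₁ x * h₂ x + g₂ x * h₁ x, fun x => h₁ x * h₂ x,
    (hg₁.mul hh₂).add (hg₂.mul hh₁), hh₁.mul hh₂,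
    not_eventually_mul_eq_zero hh₁ hh₂ h₁0 h₂0, ?_⟩
  filter_upwards [h₁F, h₂G] with x hx₁ hx₂ hx
  obtain ⟨ha, hb⟩ := mul_ne_zero_iff.1 hx
  rw [hx₁ ha, hx₂ hb]
  field_simp

theorem IsMeromorphicAt.mul {F G : (ι → ℂ) → ℂ} {p : ι → ℂ} (hF : IsMeromorphicAt F p)
    (hG : IsMeromorphicAt G p) : IsMeromorphicAt (fun x => F x * G x) p := by
  obtain ⟨g₁, h₁, hg₁, hh₁, h₁0, h₁F⟩ := hF
  obtain ⟨g₂, h₂, hg₂, hh₂, h₂0, h₂G⟩ := hG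
  refine ⟨fun x => g₁ x * g₂ x, fun x => h₁ x * h₂ x, hg₁.mul hg₂, hh₁.mul hh₂,
    not_eventually_mul_eq_zero hh₁ hh₂ h₁0 h₂0, ?_⟩
  filter_upwards [h₁F, h₂G] with x hx₁ hx₂ hx
  obtain ⟨ha, hb⟩ := mul_ne_zero_iff.1 hx
  rw [hx₁ ha, hx₂ hb, div_mul_div_comm]

theorem IsMeromorphicAt.sum {α : Type*} {F : α → (ι → ℂ) → ℂ} {p : ι → ℂ} (t : Finset α)
    (hF : ∀ a ∈ t, IsMeromorphicAt (F a) p) : IsMeromorphicAt (fun x => ∑ a ∈ t, F a x) p := by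
  classical
  induction t using Finset.induction_on with
  | empty => simpa using AnalyticAt.isMeromorphicAt analyticAt_const
  | insert a t ha ih =>
    simp only [Finset.sum_insert ha]
    exact (hF a (Finset.mem_insert_self a t)).add
      (ih fun b hb => hF b (Finset.mem_insert_of_mem hb))

/-- Restriction of vectors to a set of coordinates. -/
def coordMap (π : ι → κ) : (κ → ℂ) →L[ℂ] (ι → ℂ) := (LinearMap.funLeft ℂ ℂ π).toContinuousLinearMap

theorem map_nhds_coordMap {π : ι → κ} (hπ : Function.Injective π) (p : κ → ℂ) :
    Filter.map (coordMap π) (𝓝 p) = 𝓝 (p ∘ π) := by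
  have h : IsOpenMap (coordMap π) :=
    LinearMap.isOpenMap_of_finiteDimensional _ (LinearMap.funLeft_surjective_of_injective ℂ ℂ π hπ)
  exact h.map_nhds_eq (coordMap π).continuous.continuousAt

theorem AnalyticAt.comp_coord {F : (ι → ℂ) → ℂ} {π : ι → κ} {p : κ → ℂ}
    (hF : AnalyticAt ℂ F (p ∘ π)) : AnalyticAt ℂ (fun s => F (s ∘ π)) p :=
  AnalyticAt.fun_comp (g := F) hF ((coordMap π).analyticAt p)

theorem IsMeromorphicAt.comp_coord {F : (ι → ℂ) → ℂ} {π : ι → κ} (hπ : Function.Injective π)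
    {p : κ → ℂ} (hF : IsMeromorphicAt F (p ∘ π)) : IsMeromorphicAt (fun s => F (s ∘ π)) p := by
  obtain ⟨g, h, hg, hh, h0, hgh⟩ := hF
  rw [← map_nhds_coordMap hπ, Filter.eventually_map] at h0 hgh
  exact ⟨_, _, AnalyticAt.comp_coord hg, AnalyticAt.comp_coord hh, h0, hgh⟩

/-- On a ball where both fractions are valid, equality means that `g₁ h₂ - g₂ h₁` vanishes. This
function is analytic, so vanishing near one point of the ball spreads to all of it. -/
theorem exists_ball_meromorphicEqAt {F G : (ι → ℂ) → ℂ} {p : ι → ℂ} (hF : IsMeromorphicAt F p)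
    (hG : IsMeromorphicAt G p) : ∃ R > 0, ∀ q₀ ∈ Metric.ball p R, MeromorphicEqAt F G q₀ →
      ∀ q ∈ Metric.ball p R, MeromorphicEqAt F G q := by
  obtain ⟨g₁, h₁, hg₁, hh₁, h₁0, h₁F⟩ := hF
  obtain ⟨g₂, h₂, hg₂, hh₂, h₂0, h₂G⟩ := hG
  obtain ⟨R, hR, hB⟩ := Metric.eventually_nhds_iff_ball.1
    ((h₁F.and h₂G).and ((hg₁.eventually_analyticAt.and hh₁.eventually_analyticAt).and
      (hg₂.eventually_analyticAt.and hh₂.eventually_analyticAt)))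
  refine ⟨R, hR, fun q₀ hq₀ ⟨h, hh, h0, hFG⟩ q hq => ?_⟩
  have hh₁' : AnalyticOnNhd ℂ h₁ (Metric.ball p R) := fun x hx => (hB x hx).2.1.2
  have hh₂' : AnalyticOnNhd ℂ h₂ (Metric.ball p R) := fun x hx => (hB x hx).2.2.2
  have hE : AnalyticOnNhd ℂ (fun x => g₁ x * h₂ x - g₂ x * h₁ x) (Metric.ball p R) := fun x hx =>
    ((hB x hx).2.1.1.mul (hh₂' x hx)).sub ((hB x hx).2.2.1.mul (hh₁' x hx))
  have hne : ∀ q ∈ Metric.ball p R, ¬ ∀ᶠ x in 𝓝 q, h₁ x * h₂ x = 0 := fun q hq =>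
    not_eventually_mul_eq_zero (hh₁' q hq) (hh₂' q hq)
      (not_eventually_eq_zero_of_mem_ball hh₁' h₁0 hq)
      (not_eventually_eq_zero_of_mem_ball hh₂' h₂0 hq)
  have hE0 : ∀ᶠ x in 𝓝 q₀, g₁ x * h₂ x - g₂ x * h₁ x = 0 := by
    by_contra hcon
    refine not_eventually_mul_eq_zero (hE q₀ hq₀)
      (((hh₁' q₀ hq₀).mul (hh₂' q₀ hq₀)).mul hh) hcon
      (not_eventually_mul_eq_zero ((hh₁' q₀ hq₀).mul (hh₂' q₀ hq₀)) hh (hne q₀ hq₀) h0) ?_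
    filter_upwards [Metric.isOpen_ball.mem_nhds hq₀, hFG] with x hx hxFG
    rw [mul_eq_zero, or_iff_not_imp_right]
    intro hx0
    obtain ⟨hx12, hx3⟩ := mul_ne_zero_iff.1 hx0
    obtain ⟨hx1, hx2⟩ := mul_ne_zero_iff.1 hx12
    have := hxFG hx3
    rw [(hB x hx).1.1 hx1, (hB x hx).1.2 hx2, div_eq_div_iff hx1 hx2] at this
    rw [this, sub_self]
  have hEB := hE.eqOn_zero_of_preconnected_of_eventuallyEq_zero
    (convex_ball p R).isPreconnected hq₀ hE0
  refine ⟨fun x => h₁ x * h₂ x, (hh₁' q hq).mul (hh₂' q hq), hne q hq, ?_⟩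
  filter_upwards [Metric.isOpen_ball.mem_nhds hq] with x hx hx0
  obtain ⟨hx1, hx2⟩ := mul_ne_zero_iff.1 hx0
  rw [(hB x hx).1.1 hx1, (hB x hx).1.2 hx2, div_eq_div_iff hx1 hx2]
  exact sub_eq_zero.1 (hEB hx)

/-- The identity theorem for meromorphic functions on `ℂ^ι`. -/
theorem meromorphicEqAt_of_eventuallyEq {F G : (ι → ℂ) → ℂ} (hF : ∀ p, IsMeromorphicAt F p)
    (hG : ∀ p, IsMeromorphicAt G p) {p₀ : ι → ℂ} (h : ∀ᶠ x in 𝓝 p₀, F x = G x) (p : ι → ℂ) :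
    MeromorphicEqAt F G p := by
  -- The ball lemma, applied in both directions, shows that the set and its complement are open.
  have hclopen : IsClopen {p | MeromorphicEqAt F G p} := by
    refine ⟨⟨?_⟩, ?_⟩
    · refine isOpen_iff_mem_nhds.2 fun p hp => ?_
      obtain ⟨R, hR, hB⟩ := exists_ball_meromorphicEqAt (hF p) (hG p)
      filter_upwards [Metric.ball_mem_nhds p hR] with q hq hq'
      exact hp (hB q hq hq' p (Metric.mem_ball_self hR))
    · refine isOpen_iff_mem_nhds.2 fun p hp => ?_
      obtain ⟨R, hR, hB⟩ := exists_ball_meromorphicEqAt (hF p) (hG p)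
      filter_upwards [Metric.ball_mem_nhds p hR] with q hq
      exact hB p (Metric.mem_ball_self hR) hp q hq
  have huniv := hclopen.eq_univ ⟨p₀, fun _ => 1, analyticAt_const,
    fun h1 => one_ne_zero h1.self_of_nhds, h.mono fun x hx _ => hx⟩
  exact huniv.symm.subset (Set.mem_univ p)

theorem MeromorphicEqAt.eq_of_continuousAt {F G : (ι → ℂ) → ℂ} {p : ι → ℂ}
    (h : MeromorphicEqAt F G p) (hF : ContinuousAt F p) (hG : ContinuousAt G p) : F p = G p := by
  obtain ⟨h, -, h0, hFG⟩ := h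
  by_contra hne
  refine h0 ?_
  filter_upwards [hFG, (hF.sub hG).eventually_ne (sub_ne_zero.2 hne)] with x hx hx'
  by_contra hx0
  exact hx' (sub_eq_zero.2 (hx hx0))

end Meromorphic

/-! Operations on continuations. -/

section Continuation

variable {ι κ α β : Type} [Fintype ι] [Fintype κ]

/-- Chain sums run over all tuples, with zero terms off the chains. This transfers their
continuation to a series indexed by a subtype and with relabelled variables. -/
theorem IsContinuation.comp {term : (ι → ℂ) → α → ℂ} {D : Set (ι → ℂ)} {F : (ι → ℂ) → ℂ}
    (h : IsContinuation term D F) {π : ι → κ} (hπ : Function.Injective π) {j : β → α}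
    (hj : Function.Injective j) {D' : Set (κ → ℂ)} (hD : ∀ s ∈ D', s ∘ π ∈ D)
    {term' : (κ → ℂ) → β → ℂ} (hterm : ∀ s b, term' s b = term (s ∘ π) (j b))
    (hsupp : ∀ s, ∀ a ∉ Set.range j, term s a = 0) :
    IsContinuation term' D' (fun s => F (s ∘ π)) where
  meromorphic p := (h.meromorphic _).comp_coord hπ
  holomorphic p hp := AnalyticAt.comp_coord (h.holomorphic _ (hD p hp))
  summable s hs := by
    simp only [hterm]
    exact (h.summable _ (hD s hs)).comp_injective hj
  eq_tsum s hs := by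
    rw [h.eq_tsum _ (hD s hs)]
    simp only [hterm]
    refine (hj.tsum_eq fun a ha => ?_).symm
    by_contra hcon
    exact ha (hsupp _ a hcon)

theorem IsContinuation.sum {γ : Type*} (t : Finset γ) {term : γ → (ι → ℂ) → α → ℂ}
    {D : Set (ι → ℂ)} {F : γ → (ι → ℂ) → ℂ} (h : ∀ c ∈ t, IsContinuation (term c) D (F c))
    {term' : (ι → ℂ) → α → ℂ} (hterm : ∀ s a, term' s a = ∑ c ∈ t, term c s a) :
    IsContinuation term' D (fun s => ∑ c ∈ t, F c s) where
  meromorphic p := IsMeromorphicAt.sum t fun c hc => (h c hc).meromorphic p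
  holomorphic p hp := Finset.analyticAt_fun_sum _ fun c hc => (h c hc).holomorphic p hp
  summable s hs := by
    simp only [hterm]
    exact Summable.of_nonneg_of_le (fun _ => norm_nonneg _) (fun a => norm_sum_le _ _)
      (summable_sum fun c hc => (h c hc).summable s hs)
  eq_tsum s hs := by
    simp only [hterm]
    rw [Summable.tsum_finsetSum fun c hc => ((h c hc).summable s hs).of_norm]
    exact Finset.sum_congr rfl fun c hc => (h c hc).eq_tsum s hs

end Continuation

/-- Chain sums have meromorphic continuations. -/
theorem exists_isContinuation_chainTerm {r : ℕ} {d : Fin r → ℕ} (hd : ∀ i, d i ≤ 1) :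
    ∃ F, IsContinuation (chainTerm d) (chainDomain r) F := by
  obtain ⟨g, hg, hg'⟩ := exists_entire_extension hd
  have hga : AnalyticOnNhd ℂ g Set.univ :=
    analyticOnNhd_of_differentiableOn isOpen_univ hg.differentiableOn
  have hha : AnalyticOnNhd ℂ (chainDenom : (Fin r → ℂ) → ℂ) Set.univ :=
    analyticOnNhd_of_differentiableOn isOpen_univ (differentiable_chainDenom r).differentiableOn
  have hne : ∃ p, p ∈ chainDomain r := by
    cases r with
    | zero => exact ⟨0, trivial⟩
    | succ r => exact ⟨fun _ => 2, mem_chainDomain_of_one_le (by norm_num) fun _ => by norm_num⟩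
  obtain ⟨q, hq⟩ := hne
  refine ⟨fun s => g s / chainDenom s, ?_, ?_, ?_, ?_⟩
  · refine fun p => ⟨g, chainDenom, hga p trivial, hha p trivial, fun h0 => ?_,
      Filter.Eventually.of_forall fun _ _ => rfl⟩
    exact chainDenom_ne_zero hq (hha.eqOn_zero_of_preconnected_of_eventuallyEq_zero
      isPreconnected_univ (Set.mem_univ p) h0 (Set.mem_univ q))
  · exact fun s hs => (hga s trivial).div (hha s trivial) (chainDenom_ne_zero hs)
  · exact fun s hs => summable_norm_chainTerm d hs
  · intro s hs
    rw [hg' s hs, mul_div_cancel_left₀ _ (chainDenom_ne_zero hs), chainSum]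

/-! The Euler-Zagier series and the anti-hook series as (sums of) chain sums. -/

theorem isChain_iff {r : ℕ} (d : Fin r → ℕ) (m : Fin r → ℕ+) :
    IsChain d m ↔ ∀ i : Fin r,
      (if h : (i : ℕ) + 1 < r then (m ⟨i + 1, h⟩ : ℕ) else 1) + d i ≤ m i := by
  induction r with
  | zero => simp [IsChain]
  | succ r ih =>
    rw [IsChain, ih, Fin.forall_fin_succ]
    refine and_congr ?_ (forall_congr' fun i => ?_)
    · cases r with
      | zero => simp [topEntry]
      | succ r => simp [topEntry, Fin.tail]
    · simp [Fin.tail]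

/-- The gaps of the chains `m ∘ Fin.rev`, where `m` is weakly increasing and strictly increasing at
the descents of the labels. -/
def descGap {r : ℕ} (lab : Fin r → Fin r) (i : Fin r) : ℕ :=
  if h : (i : ℕ) + 1 < r then if lab (Fin.rev ⟨i + 1, h⟩) < lab (Fin.rev i) then 0 else 1 else 0

theorem descGap_le_one {r : ℕ} (lab : Fin r → Fin r) (i : Fin r) : descGap lab i ≤ 1 := by
  unfold descGap
  split_ifs <;> simp

/-- Consecutive entries may be equal exactly where the label ascends, so the gap is 0 there and 1
elsewhere. The reversal appears because chains list the largest entry first. -/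
theorem strictMono_toLex_iff_isChain {r : ℕ} {lab : Fin r → Fin r} (hlab : Function.Injective lab)
    (m : Fin r → ℕ+) :
    StrictMono (fun i => toLex (m i, lab i)) ↔ IsChain (descGap lab) (m ∘ Fin.rev) := by
  rw [isChain_iff]
  cases r with
  | zero => exact ⟨fun _ i => i.elim0, fun _ i => i.elim0⟩
  | succ n =>
    have hkey : ∀ i : Fin n, toLex (m i.castSucc, lab i.castSucc) < toLex (m i.succ, lab i.succ) ↔
        (m i.castSucc : ℕ) + (if lab i.castSucc < lab i.succ then 0 else 1) ≤ m i.succ := by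
      intro i
      have hne : lab i.castSucc ≠ lab i.succ := fun h => (Fin.castSucc_lt_succ (i := i)).ne (hlab h)
      rw [Prod.Lex.toLex_lt_toLex, ← PNat.coe_lt_coe, ← PNat.coe_inj]
      split_ifs with h
      · simp only [h, and_true, add_zero]
        omega
      · simp only [h, and_false, or_false]
        omega
    rw [Fin.strictMono_iff_lt_succ]
    constructor
    · intro h i
      by_cases hi : (i : ℕ) + 1 < n + 1
      · have h1 := (hkey ⟨n - 1 - i, by omega⟩).1 (h _)
        have e1 : Fin.castSucc ⟨n - 1 - i, by omega⟩ = Fin.rev ⟨(i : ℕ) + 1, hi⟩ := by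
          ext
          simp [Fin.val_rev]
          omega
        have e2 : Fin.succ ⟨n - 1 - i, by omega⟩ = Fin.rev i := by
          ext
          simp [Fin.val_rev]
          omega
        rw [e1, e2] at h1
        simpa only [descGap, dif_pos hi, Function.comp_apply] using h1
      -- The final entry of the chain has default neighbour 1 and gap 0, so its condition is only
      -- positivity.
      · simp only [descGap, dif_neg hi, add_zero]
        exact PNat.pos _
    · intro h i
      rw [hkey]
      have hi : ((Fin.rev i.succ : Fin (n + 1)) : ℕ) + 1 < n + 1 := by
        have := i.isLt
        simp only [Fin.val_rev, Fin.val_succ]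
        omega
      have h1 := h (Fin.rev i.succ)
      have e1 : Fin.rev ⟨((Fin.rev i.succ : Fin (n + 1)) : ℕ) + 1, hi⟩ = i.castSucc := by
        ext
        simp [Fin.val_rev]
        omega
      simp only [descGap, dif_pos hi, Function.comp_apply, e1, Fin.rev_rev] at h1
      exact h1

theorem powProd_comp_equiv {r : ℕ} {κ : Type*} [Fintype κ] (e : Fin r ≃ κ) (s : κ → ℂ)
    (m : κ → ℕ+) : powProd (s ∘ e) (m ∘ e) = ∏ a, ((m a : ℕ) : ℂ) ^ (-s a) :=
  Equiv.prod_comp e fun a => ((m a : ℕ) : ℂ) ^ (-s a)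

theorem comp_rev_mem_chainDomain {r : ℕ} {s : Fin r → ℂ} (h : ∀ i, 1 ≤ (s i).re)
    (h' : ∀ i : Fin r, (i : ℕ) + 1 = r → 1 < (s i).re) : s ∘ Fin.rev ∈ chainDomain r := by
  cases r with
  | zero => trivial
  | succ r =>
    exact mem_chainDomain_of_one_le (h' _ (by simp)) fun i => h _

/-- Decreasing labels forbid every tie; the identity labelling, used for the star series, permits
every tie. -/
theorem strictMono_iff_isChain {r : ℕ} (m : Fin r → ℕ+) :
    StrictMono m ↔ IsChain (descGap Fin.rev) (m ∘ Fin.rev) := by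
  rw [← strictMono_toLex_iff_isChain Fin.rev_injective]
  refine forall_congr' fun i => forall_congr' fun j => forall_congr' fun hij => ?_
  simp only [Prod.Lex.toLex_lt_toLex, Fin.rev_lt_rev, hij.not_gt, and_false, or_false]

theorem monotone_iff_isChain {r : ℕ} (m : Fin r → ℕ+) :
    Monotone m ↔ IsChain (descGap id) (m ∘ Fin.rev) := by
  rw [← strictMono_toLex_iff_isChain Function.injective_id, monotone_iff_forall_lt]
  refine forall_congr' fun i => forall_congr' fun j => forall_congr' fun hij => ?_
  simp only [Prod.Lex.toLex_lt_toLex, id, hij, and_true, le_iff_lt_or_eq]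

theorem chainTerm_of_isChain {r : ℕ} {d : Fin r → ℕ} {m : Fin r → ℕ+} (h : IsChain d m)
    (s : Fin r → ℂ) : chainTerm d s m = powProd s m :=
  Set.indicator_of_mem (s := {m | IsChain d m}) h _

theorem chainTerm_of_not_isChain {r : ℕ} {d : Fin r → ℕ} {m : Fin r → ℕ+} (h : ¬ IsChain d m)
    (s : Fin r → ℂ) : chainTerm d s m = 0 :=
  Set.indicator_of_notMem (s := {m | IsChain d m}) h _

theorem comp_rev_injective {r : ℕ} {γ : Type*} :
    Function.Injective fun m : Fin r → γ => m ∘ Fin.rev :=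
  Fin.rev_surjective.injective_comp_right

theorem exists_isContinuation_ezTerm (r : ℕ) :
    ∃ B, IsContinuation (ezTerm r) (ezDomain r) B := by
  obtain ⟨F, hF⟩ := exists_isContinuation_chainTerm (descGap_le_one (Fin.rev : Fin r → Fin r))
  refine ⟨_, hF.comp (π := Fin.rev) Fin.rev_injective (j := fun m : EZIndex r => m.1 ∘ Fin.rev)
    (comp_rev_injective.comp Subtype.val_injective)
    (fun s hs => comp_rev_mem_chainDomain (fun i => (hs i).1) fun i => (hs i).2) ?_ ?_⟩
  · intro s m
    rw [chainTerm_of_isChain ((strictMono_iff_isChain _).1 m.2)]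
    exact (powProd_comp_equiv Fin.revPerm s m.1).symm
  · intro s a ha
    refine chainTerm_of_not_isChain (fun hc => ha ?_) s
    have ha' : (a ∘ Fin.rev) ∘ Fin.rev = a := by ext; simp
    exact ⟨⟨a ∘ Fin.rev, (strictMono_iff_isChain _).2 (by rwa [ha'])⟩, ha'⟩

theorem exists_isContinuation_ezStarTerm (r : ℕ) :
    ∃ A, IsContinuation (ezStarTerm r) (ezDomain r) A := by
  obtain ⟨F, hF⟩ := exists_isContinuation_chainTerm (descGap_le_one (id : Fin r → Fin r))
  refine ⟨_, hF.comp (π := Fin.rev) Fin.rev_injective (j := fun m : EZStarIndex r => m.1 ∘ Fin.rev)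
    (comp_rev_injective.comp Subtype.val_injective)
    (fun s hs => comp_rev_mem_chainDomain (fun i => (hs i).1) fun i => (hs i).2) ?_ ?_⟩
  · intro s m
    rw [chainTerm_of_isChain ((monotone_iff_isChain _).1 m.2)]
    exact (powProd_comp_equiv Fin.revPerm s m.1).symm
  · intro s a ha
    refine chainTerm_of_not_isChain (fun hc => ha ?_) s
    have ha' : (a ∘ Fin.rev) ∘ Fin.rev = a := by ext; simp
    exact ⟨⟨a ∘ Fin.rev, (monotone_iff_isChain _).2 (by rwa [ha'])⟩, ha'⟩

/-! The boxes of the anti-hook, numbered from left to right and then from bottom to top. -/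

theorem mem_rib_iff {k ℓ : ℕ} {x : ℕ × ℕ} :
    x ∈ rib k ℓ ↔ (x.1 = ℓ ∧ x.2 ≤ k) ∨ (x.1 ≤ ℓ ∧ x.2 = k) := by
  simp only [rib, skewBoxes, rect, Finset.mem_sdiff, Finset.mem_product, Finset.mem_range]
  omega

/-- The numbering of the boxes of the anti-hook. -/
def ribEquiv (k ℓ : ℕ) : Fin (k + ℓ + 1) ≃ rib k ℓ where
  toFun a := ⟨(ℓ - (a - k), min a k), by rw [mem_rib_iff]; simp only; omega⟩
  invFun x := ⟨x.1.2 + (ℓ - x.1.1), by have := mem_rib_iff.1 x.2; omega⟩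
  left_inv a := by
    ext
    simp only
    omega
  right_inv x := by
    have := mem_rib_iff.1 x.2
    ext
    · simp only
      omega
    · simp only
      omega

theorem ribEquiv_val (k ℓ : ℕ) (a : Fin (k + ℓ + 1)) :
    (ribEquiv k ℓ a).1 = (ℓ - (a - k), min (a : ℕ) k) := rfl

/-- Weakly increasing up to index `i`, strictly decreasing from there on. -/
def IsUpDown {n : ℕ} (i : ℕ) (f : Fin n → ℕ+) : Prop :=
  (∀ a b : Fin n, a < b → (b : ℕ) ≤ i → f a ≤ f b) ∧
    ∀ a b : Fin n, a < b → i ≤ (a : ℕ) → f b < f a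

theorem isSSYT_rib_iff {k ℓ : ℕ} (M : rib k ℓ → ℕ+) :
    ((∀ a b : rib k ℓ, a.1.1 = b.1.1 → a.1.2 ≤ b.1.2 → M a ≤ M b) ∧
      (∀ a b : rib k ℓ, a.1.2 = b.1.2 → a.1.1 < b.1.1 → M a < M b)) ↔
    IsUpDown k (M ∘ ribEquiv k ℓ) := by
  constructor
  · rintro ⟨h1, h2⟩
    refine ⟨fun a b hab hb => h1 _ _ ?_ ?_, fun a b hab ha => h2 _ _ ?_ ?_⟩ <;>
    · rw [Fin.lt_def] at hab
      have := b.isLt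
      simp only [ribEquiv_val]
      omega
  · rintro ⟨h1, h2⟩
    refine ⟨fun a b hr hc => ?_, fun a b hc hr => ?_⟩ <;>
    obtain ⟨a, rfl⟩ := (ribEquiv k ℓ).surjective a <;>
    obtain ⟨b, rfl⟩ := (ribEquiv k ℓ).surjective b <;>
    simp only [ribEquiv_val] at hr hc <;>
    have ha := a.isLt <;>
    have hb := b.isLt
    · rcases lt_trichotomy a b with hab | rfl | hab
      · refine h1 a b hab ?_
        rw [Fin.lt_def] at hab
        omega
      · exact le_rfl
      · rw [Fin.lt_def] at hab
        omega
    · refine h2 b a ?_ ?_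
      · rw [Fin.lt_def]
        omega
      · omega

/-- The tableaux of anti-hook shape as tuples. -/
def ssytEquiv (k ℓ : ℕ) : SSYT (rib k ℓ) ≃ {f : Fin (k + ℓ + 1) → ℕ+ // IsUpDown k f} where
  toFun M := ⟨M.1 ∘ ribEquiv k ℓ, (isSSYT_rib_iff _).1 M.2⟩
  invFun f := ⟨f.1 ∘ (ribEquiv k ℓ).symm, (isSSYT_rib_iff _).2 (by
    rw [Function.comp_assoc, Equiv.symm_comp_self]
    exact f.2)⟩
  left_inv M := by
    refine Subtype.ext ?_
    ext
    simp
  right_inv f := by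
    refine Subtype.ext ?_
    ext
    simp

theorem schurTerm_eq_powProd {k ℓ : ℕ} (s : rib k ℓ → ℂ) (M : SSYT (rib k ℓ)) :
    schurTerm (rib k ℓ) s M = powProd (s ∘ ribEquiv k ℓ) (ssytEquiv k ℓ M).1 :=
  (powProd_comp_equiv (ribEquiv k ℓ) s M.1).symm

/-! ### Decomposition of the anti-hook series by linear extensions. -/

/-- The orderings of the entries that occur in tableaux of anti-hook shape. -/
def IsLinearExt {n : ℕ} (k : ℕ) (σ : Equiv.Perm (Fin n)) : Prop :=
  (∀ a b : Fin n, a < b → (b : ℕ) ≤ k → σ.symm a < σ.symm b) ∧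
    ∀ a b : Fin n, a < b → k ≤ (a : ℕ) → σ.symm b < σ.symm a

/-- The tie-breaking rule matches the tableau conditions: for `a < b`, box `a` precedes `b` in
sorted order iff `f a ≤ f b`, and `b` precedes `a` iff `f b < f a`. -/
theorem isUpDown_iff_isLinearExt {n k : ℕ} {f : Fin n → ℕ+} {σ : Equiv.Perm (Fin n)}
    (h : StrictMono fun i => toLex ((f ∘ σ) i, σ i)) : IsUpDown k f ↔ IsLinearExt k σ := by
  have hlt : ∀ a b, σ.symm a < σ.symm b ↔ f a < f b ∨ f a = f b ∧ a < b := by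
    intro a b
    rw [← h.lt_iff_lt, Prod.Lex.toLex_lt_toLex]
    simp
  refine and_congr ?_ ?_ <;>
    refine forall_congr' fun a => forall_congr' fun b => forall_congr' fun hab =>
      forall_congr' fun _ => ?_
  · rw [hlt, le_iff_lt_or_eq]
    simp [hab]
  · rw [hlt]
    simp [hab.not_gt]

/-- The corner box is the maximum of the order, so it always carries the first variable of the chain
sum, the one that needs real part greater than 1. -/
theorem isLinearExt_last {n k : ℕ} (hk : k < n + 1) {σ : Equiv.Perm (Fin (n + 1))}
    (h : IsLinearExt k σ) : σ (Fin.last n) = ⟨k, hk⟩ := by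
  by_contra hne
  have hle : ∀ a : Fin (n + 1), a ≠ ⟨k, hk⟩ → σ.symm a < σ.symm ⟨k, hk⟩ := by
    intro a ha
    rcases lt_or_gt_of_ne ha with hlt | hgt
    · exact h.1 a _ hlt le_rfl
    · exact h.2 _ a hgt le_rfl
  have := hle _ hne
  rw [Equiv.symm_apply_apply] at this
  exact absurd this (not_lt.2 (Fin.le_last _))

theorem isCorner_rib {k ℓ : ℕ} (a : Fin (k + ℓ + 1)) (ha : (a : ℕ) = k) :
    IsCorner (rib k ℓ) (ribEquiv k ℓ a) := by
  simp only [IsCorner, mem_rib_iff, ribEquiv_val]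
  omega

theorem exists_isContinuation_rib (k ℓ : ℕ) :
    ∃ Z, IsContinuation (schurTerm (rib k ℓ)) (schurDomain (rib k ℓ)) Z := by
  classical
  choose F hF using fun σ : Equiv.Perm (Fin (k + ℓ + 1)) =>
    exists_isContinuation_chainTerm (descGap_le_one σ)
  set e := ribEquiv k ℓ
  have hinj : ∀ σ : Equiv.Perm (Fin (k + ℓ + 1)),
      Function.Injective (e ∘ σ ∘ (Fin.rev : Fin (k + ℓ + 1) → _)) := fun σ =>
    e.injective.comp (σ.injective.comp Fin.rev_injective)
  have hsurj : ∀ σ : Equiv.Perm (Fin (k + ℓ + 1)),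
      Function.Surjective (e ∘ σ ∘ (Fin.rev : Fin (k + ℓ + 1) → _)) := fun σ =>
    e.surjective.comp (σ.surjective.comp Fin.rev_surjective)
  -- Each tuple is a chain for exactly one permutation, its stable sort, so every tableau is counted
  -- once.
  have hchain : ∀ (σ : Equiv.Perm (Fin (k + ℓ + 1))) (f : Fin (k + ℓ + 1) → ℕ+),
      IsChain (descGap σ) (f ∘ σ ∘ Fin.rev) ↔ σ = Tuple.sort f := by
    intro σ f
    rw [Tuple.eq_sort_iff', ← Function.comp_assoc, ← strictMono_toLex_iff_isChain σ.injective]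
    rfl
  have hlin : ∀ (σ : Equiv.Perm (Fin (k + ℓ + 1))) (f : Fin (k + ℓ + 1) → ℕ+),
      IsChain (descGap σ) (f ∘ σ ∘ Fin.rev) → (IsUpDown k f ↔ IsLinearExt k σ) := by
    intro σ f h
    rw [← Function.comp_assoc, ← strictMono_toLex_iff_isChain σ.injective] at h
    exact isUpDown_iff_isLinearExt h
  refine ⟨_, IsContinuation.sum (Finset.univ.filter (IsLinearExt k))
    (term := fun σ s M => chainTerm (descGap σ) (s ∘ e ∘ σ ∘ Fin.rev) (M.1 ∘ e ∘ σ ∘ Fin.rev))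
    (F := fun σ s => F σ (s ∘ e ∘ σ ∘ Fin.rev)) (fun σ hσ => ?_) fun s M => ?_⟩
  · have hσ' : IsLinearExt k σ := (Finset.mem_filter.1 hσ).2
    refine (hF σ).comp (π := e ∘ σ ∘ Fin.rev) (hinj σ)
      (j := fun M : SSYT (rib k ℓ) => M.1 ∘ e ∘ σ ∘ Fin.rev)
      ((hsurj σ).injective_comp_right.comp Subtype.val_injective) (fun s hs => ?_)
      (fun s M => rfl) fun s a ha => ?_
    · refine mem_chainDomain_of_one_le ?_ fun i => (hs _).1
      refine (hs _).2 (isCorner_rib _ ?_)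
      rw [Function.comp_apply, Fin.rev_zero, isLinearExt_last (by omega) hσ']
    · refine chainTerm_of_not_isChain (fun hc => ha ?_) s
      obtain ⟨f, rfl⟩ : ∃ f : Fin (k + ℓ + 1) → ℕ+, f ∘ σ ∘ Fin.rev = a :=
        ⟨a ∘ Fin.rev ∘ σ.symm, by ext; simp⟩
      refine ⟨(ssytEquiv k ℓ).symm ⟨f, (hlin σ f hc).2 hσ'⟩, ?_⟩
      exact funext fun i => congrArg f (e.symm_apply_apply (σ i.rev))
  · set f := M.1 ∘ e
    have hM : IsUpDown k f := (isSSYT_rib_iff _).1 M.2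
    have hsort := (hchain (Tuple.sort f) f).2 rfl
    have hmem : Tuple.sort f ∈ Finset.univ.filter (IsLinearExt (n := k + ℓ + 1) k) :=
      Finset.mem_filter.2 ⟨Finset.mem_univ _, (hlin _ f hsort).1 hM⟩
    rw [Finset.sum_eq_single_of_mem _ hmem]
    · exact ((chainTerm_of_isChain hsort (s ∘ e ∘ Tuple.sort f ∘ Fin.rev)).trans
        (powProd_comp_equiv (Fin.revPerm.trans ((Tuple.sort f).trans e)) s M.1)).symm
    · intro σ _ hσ
      exact chainTerm_of_not_isChain (fun hc => hσ ((hchain σ f).1 hc)) _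

/-! The identity between the series. -/

/-- The first `i` indices, and the other ones in reverse order. -/
def splitEquiv (k ℓ : ℕ) (i : Fin (k + 1)) : Fin i ⊕ Fin (ℓ + k - i + 1) ≃ Fin (k + ℓ + 1) where
  toFun := Sum.elim (fun a => ⟨a, by omega⟩) (fun b => ⟨k + ℓ - b, by omega⟩)
  invFun c := if h : (c : ℕ) < i then Sum.inl ⟨c, h⟩ else Sum.inr ⟨k + ℓ - c, by omega⟩
  left_inv x := by
    rcases x with a | b
    · simp
    · have h : ¬ (k + ℓ - b < (i : ℕ)) := by omega
      refine (dif_neg h).trans (congrArg Sum.inr (Fin.ext ?_))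
      simp only [Sum.elim_inr]
      omega
  right_inv c := by
    by_cases h : (c : ℕ) < i
    · simp [h]
    · simp only [dif_neg h, Sum.elim_inr]
      ext
      simp only
      omega

theorem splitEquiv_inl_val (k ℓ : ℕ) (i : Fin (k + 1)) (a : Fin i) :
    (splitEquiv k ℓ i (Sum.inl a) : ℕ) = a := rfl

theorem splitEquiv_inr_val (k ℓ : ℕ) (i : Fin (k + 1)) (b : Fin (ℓ + k - i + 1)) :
    (splitEquiv k ℓ i (Sum.inr b) : ℕ) = k + ℓ - b := rfl

theorem starArgs_eq (k ℓ : ℕ) (i : Fin (k + 1)) (s : rib k ℓ → ℂ) :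
    starArgs k ℓ i s = s ∘ (ribEquiv k ℓ ∘ splitEquiv k ℓ i ∘ Sum.inl) := by
  ext a
  refine congrArg s (Subtype.ext (Prod.ext ?_ ?_)) <;>
  · simp only [rowBox, Function.comp_apply, ribEquiv_val, splitEquiv_inl_val]
    omega

theorem ezArgs_eq (k ℓ : ℕ) (i : Fin (k + 1)) (s : rib k ℓ → ℂ) :
    ezArgs k ℓ i s = s ∘ (ribEquiv k ℓ ∘ splitEquiv k ℓ i ∘ Sum.inr) := by
  ext a
  unfold ezArgs
  split_ifs with h <;>
  refine congrArg s (Subtype.ext (Prod.ext ?_ ?_)) <;>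
  · simp only [rowBox, colBox, Function.comp_apply, ribEquiv_val, splitEquiv_inr_val]
    omega

/-- Weakly increasing before index `i`, strictly decreasing from there on. -/
def IsSplit {n : ℕ} (i : ℕ) (f : Fin n → ℕ+) : Prop :=
  (∀ a b : Fin n, a < b → (b : ℕ) < i → f a ≤ f b) ∧
    ∀ a b : Fin n, a < b → i ≤ (a : ℕ) → f b < f a

theorem isSplit_iff {k ℓ : ℕ} (i : Fin (k + 1)) (f : Fin (k + ℓ + 1) → ℕ+) :
    IsSplit i f ↔ Monotone (f ∘ splitEquiv k ℓ i ∘ Sum.inl) ∧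
      StrictMono (f ∘ splitEquiv k ℓ i ∘ Sum.inr) := by
  refine and_congr ?_ ?_
  · rw [monotone_iff_forall_lt]
    constructor
    · intro h a b hab
      exact h _ _ hab b.isLt
    · intro h a b hab hb
      exact h (a := ⟨a, lt_trans hab hb⟩) (b := ⟨b, hb⟩) hab
  · constructor
    · intro h a b hab
      rw [Fin.lt_def] at hab
      refine h _ _ ?_ ?_
      · simp only [Function.comp_apply, Fin.lt_def, splitEquiv_inr_val]
        omega
      · simp only [Function.comp_apply, splitEquiv_inr_val]
        omega
    · intro h a b hab ha
      rw [Fin.lt_def] at hab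
      have h1 := h (a := ⟨k + ℓ - b, by omega⟩) (b := ⟨k + ℓ - a, by omega⟩) (by
        rw [Fin.lt_def]
        simp only
        omega)
      have e1 : splitEquiv k ℓ i (Sum.inr ⟨k + ℓ - b, by omega⟩) = b := by
        ext
        simp only [splitEquiv_inr_val]
        omega
      have e2 : splitEquiv k ℓ i (Sum.inr ⟨k + ℓ - a, by omega⟩) = a := by
        ext
        simp only [splitEquiv_inr_val]
        omega
      simp only [Function.comp_apply, e1, e2] at h1
      exact h1

/-- A tuple that is weakly increasing before `i` and strictly decreasing from there on is a pair of
index tuples of the star series and the Euler-Zagier series. -/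
def isSplitEquiv (k ℓ : ℕ) (i : Fin (k + 1)) :
    EZStarIndex i × EZIndex (ℓ + k - i + 1) ≃ {f : Fin (k + ℓ + 1) → ℕ+ // IsSplit i f} where
  toFun p := ⟨Sum.elim p.1.1 p.2.1 ∘ (splitEquiv k ℓ i).symm, (isSplit_iff i _).2 (by
    simpa [Function.comp_def] using And.intro p.1.2 p.2.2)⟩
  invFun f := (⟨_, ((isSplit_iff i f.1).1 f.2).1⟩, ⟨_, ((isSplit_iff i f.1).1 f.2).2⟩)
  left_inv p := by
    refine Prod.ext (Subtype.ext ?_) (Subtype.ext ?_) <;> simp [Function.comp_def]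
  right_inv f := by
    refine Subtype.ext (funext fun c => ?_)
    obtain ⟨x, rfl⟩ := (splitEquiv k ℓ i).surjective c
    rcases x with a | b <;> simp

theorem powProd_isSplitEquiv {k ℓ : ℕ} (i : Fin (k + 1)) (s : rib k ℓ → ℂ)
    (p : EZStarIndex i × EZIndex (ℓ + k - i + 1)) :
    powProd (s ∘ ribEquiv k ℓ) (isSplitEquiv k ℓ i p).1 =
      ezStarTerm i (starArgs k ℓ i s) p.1 * ezTerm _ (ezArgs k ℓ i s) p.2 := by
  rw [powProd, ← (splitEquiv k ℓ i).prod_comp, Fintype.prod_sum_type, starArgs_eq, ezArgs_eq]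
  simp [isSplitEquiv, ezStarTerm, ezTerm]

theorem mem_ezDomain_of_one_lt {r : ℕ} {s : Fin r → ℂ} (h : ∀ i, 1 < (s i).re) : s ∈ ezDomain r :=
  fun i => ⟨(h i).le, fun _ => h i⟩

theorem hasSum_isSplit {k ℓ : ℕ} (i : Fin (k + 1)) {s : rib k ℓ → ℂ} (hs : ∀ a, 1 < (s a).re) :
    HasSum (Set.indicator {f | IsSplit i f} (powProd (s ∘ ribEquiv k ℓ)))
      (zetaEZStar i (starArgs k ℓ i s) * zetaEZ (ℓ + k - i + 1) (ezArgs k ℓ i s)) := by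
  obtain ⟨A, hA⟩ := exists_isContinuation_ezStarTerm i
  obtain ⟨B, hB⟩ := exists_isContinuation_ezTerm (ℓ + k - i + 1)
  have h1 := hA.summable _ (mem_ezDomain_of_one_lt (s := starArgs k ℓ i s) fun a => by
    rw [starArgs_eq]
    exact hs _)
  have h2 := hB.summable _ (mem_ezDomain_of_one_lt (s := ezArgs k ℓ i s) fun a => by
    rw [ezArgs_eq]
    exact hs _)
  have h3 := (summable_mul_of_summable_norm h1 h2).hasSum
  rw [← tsum_mul_tsum_of_summable_norm h1 h2] at h3
  have h4 : HasSum (fun f : {f : Fin (k + ℓ + 1) → ℕ+ // IsSplit i f} =>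
      powProd (s ∘ ribEquiv k ℓ) f.1)
      (zetaEZStar i (starArgs k ℓ i s) * zetaEZ (ℓ + k - i + 1) (ezArgs k ℓ i s)) := by
    rw [← (isSplitEquiv k ℓ i).hasSum_iff]
    refine HasSum.congr_fun h3 fun p => ?_
    exact powProd_isSplitEquiv i s p
  exact hasSum_subtype_iff_indicator.1 h4

theorem isSplit_zero_iff {n : ℕ} (f : Fin n → ℕ+) : IsSplit 0 f ↔ IsUpDown 0 f := by
  refine and_congr_left fun _ => ⟨fun _ a b hab hb => ?_, fun _ a b hab hb => ?_⟩
  · rw [Fin.lt_def] at hab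
    omega
  · omega

theorem IsUpDown.isSplit {n i : ℕ} {f : Fin n → ℕ+} (h : IsUpDown i f) : IsSplit i f :=
  ⟨fun a b hab hb => h.1 a b hab hb.le, h.2⟩

theorem IsUpDown.isSplit_succ {n i : ℕ} {f : Fin n → ℕ+} (h : IsUpDown i f) : IsSplit (i + 1) f :=
  ⟨fun a b hab hb => h.1 a b hab (by omega), fun a b hab ha => h.2 a b hab (by omega)⟩

theorem IsSplit.isUpDown {n i : ℕ} (hi : i + 1 < n) {f : Fin n → ℕ+} (h : IsSplit (i + 1) f)
    (hlt : f ⟨i + 1, hi⟩ < f ⟨i, by omega⟩) : IsUpDown i f := by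
  refine ⟨fun a b hab hb => h.1 a b hab (by omega), fun a b hab ha => ?_⟩
  rcases Nat.lt_or_ge i a with h1 | h1
  · exact h.2 a b hab h1
  · have ha' : a = ⟨i, by omega⟩ := Fin.ext (by simp only; omega)
    rw [ha'] at hab ⊢
    rw [Fin.lt_def] at hab
    rcases Nat.lt_or_ge (i + 1) b with h2 | h2
    · exact (h.2 ⟨i + 1, hi⟩ b h2 le_rfl).trans hlt
    · obtain rfl : b = ⟨i + 1, hi⟩ := Fin.ext (by simp only at hab ⊢; omega)
      exact hlt

theorem IsSplit.isUpDown_succ {n i : ℕ} (hi : i + 1 < n) {f : Fin n → ℕ+} (h : IsSplit (i + 1) f)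
    (hle : f ⟨i, by omega⟩ ≤ f ⟨i + 1, hi⟩) : IsUpDown (i + 1) f := by
  refine ⟨fun a b hab hb => ?_, h.2⟩
  rcases Nat.lt_or_ge b (i + 1) with h1 | h1
  · exact h.1 a b hab h1
  · obtain rfl : b = ⟨i + 1, hi⟩ := Fin.ext (by simp only; omega)
    rw [Fin.lt_def] at hab
    rcases Nat.lt_or_ge a i with h2 | h2
    · exact (h.1 a ⟨i, by omega⟩ h2 (Nat.lt_succ_self i)).trans hle
    · have ha' : a = ⟨i, by omega⟩ := Fin.ext (by simp only at hab ⊢; omega)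
      rw [ha']
      exact hle

/-- The step from `i` to `i + 1` is free on the left. If it is a weak rise the peak is at `i + 1`,
if it is a strict fall the peak is at `i`, and the cases exclude each other. -/
theorem indicator_isSplit_succ {n i : ℕ} (hi : i + 1 < n) (φ : (Fin n → ℕ+) → ℂ) :
    Set.indicator {f | IsSplit (i + 1) f} φ =
      Set.indicator {f | IsUpDown (i + 1) f} φ + Set.indicator {f | IsUpDown i f} φ := by
  have hunion : {f : Fin n → ℕ+ | IsSplit (i + 1) f} =
      {f | IsUpDown (i + 1) f} ∪ {f | IsUpDown i f} := by
    ext f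
    constructor
    · intro h
      rcases lt_or_ge (f ⟨i + 1, hi⟩) (f ⟨i, by omega⟩) with hlt | hle
      · exact Or.inr (IsSplit.isUpDown hi h hlt)
      · exact Or.inl (IsSplit.isUpDown_succ hi h hle)
    · rintro (h | h)
      · exact IsUpDown.isSplit h
      · exact IsUpDown.isSplit_succ h
  rw [hunion, Set.indicator_union_of_disjoint]
  · rfl
  · rw [Set.disjoint_left]
    intro f h1 h2
    have hlt : (⟨i, by omega⟩ : Fin n) < ⟨i + 1, hi⟩ := Fin.lt_def.2 (Nat.lt_succ_self i)
    exact absurd (h2.2 _ _ hlt le_rfl) (not_lt.2 (h1.1 _ _ hlt le_rfl))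

theorem sum_alternating_eq {x S : ℕ → ℂ} (k : ℕ) (h0 : S 0 = x 0)
    (h : ∀ i, i < k → S (i + 1) = x (i + 1) + x i) :
    ∑ i ∈ Finset.range (k + 1), (-1 : ℂ) ^ (k - i) * S i = x k := by
  induction k with
  | zero => simp [h0]
  | succ k ih =>
    have h1 : ∀ i ∈ Finset.range (k + 1), (-1 : ℂ) ^ (k + 1 - i) * S i =
        -((-1 : ℂ) ^ (k - i) * S i) := by
      intro i hi
      rw [Nat.sub_add_comm (Nat.lt_succ_iff.1 (Finset.mem_range.1 hi)), pow_succ]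
      ring
    rw [Finset.sum_range_succ, Finset.sum_congr rfl h1, Finset.sum_neg_distrib,
      ih fun i hi => h i (by omega), h k (by omega)]
    simp

theorem zetaSchur_rib_eq {k ℓ : ℕ} {s : rib k ℓ → ℂ} (hs : ∀ a, 1 < (s a).re) :
    zetaSchur (rib k ℓ) s = ∑ i : Fin (k + 1), (-1 : ℂ) ^ (k - (i : ℕ)) *
      zetaEZStar i (starArgs k ℓ i s) * zetaEZ (ℓ + k - i + 1) (ezArgs k ℓ i s) := by
  set φ := powProd (s ∘ ribEquiv k ℓ)
  set S : ℕ → ℂ := fun i => ∑' f, Set.indicator {f | IsSplit i f} φ f with hS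
  set x : ℕ → ℂ := fun i => ∑' f, Set.indicator {f | IsUpDown i f} φ f with hx
  have hterm : ∀ i : Fin (k + 1), (-1 : ℂ) ^ (k - (i : ℕ)) *
      zetaEZStar i (starArgs k ℓ i s) * zetaEZ (ℓ + k - i + 1) (ezArgs k ℓ i s) =
      (-1 : ℂ) ^ (k - (i : ℕ)) * S i := by
    intro i
    rw [mul_assoc, ← (hasSum_isSplit i hs).tsum_eq]
  rw [Finset.sum_congr rfl fun i _ => hterm i,
    Fin.sum_univ_eq_sum_range (fun i => (-1 : ℂ) ^ (k - i) * S i)]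
  -- Up-down tuples with peak `i` are among the split ones at `i`, whose sum converges as a product
  -- of two absolutely convergent series.
  have hsum : ∀ i, i ≤ k → Summable (Set.indicator {f | IsUpDown i f} φ) := by
    intro i hi
    have hsub : {f : Fin (k + ℓ + 1) → ℕ+ | IsUpDown i f} ⊆ {f | IsSplit i f} :=
      fun f hf => IsUpDown.isSplit hf
    have h1 : Summable (Set.indicator {f | IsUpDown i f} (Set.indicator {f | IsSplit i f} φ)) :=
      (hasSum_isSplit ⟨i, Nat.lt_succ_of_le hi⟩ hs).summable.indicator _
    rw [Set.indicator_indicator, Set.inter_eq_left.2 hsub] at h1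
    exact h1
  rw [sum_alternating_eq (x := x) k]
  · have h1 : x k = ∑' f : {f : Fin (k + ℓ + 1) → ℕ+ // IsUpDown k f}, φ f.1 :=
      (tsum_subtype {f | IsUpDown k f} φ).symm
    rw [h1, ← (ssytEquiv k ℓ).tsum_eq, zetaSchur]
    exact tsum_congr fun M => schurTerm_eq_powProd s M
  · simp only [hS, hx, isSplit_zero_iff]
  · intro i hi
    simp only [hS, hx]
    rw [indicator_isSplit_succ (by omega) φ, ← (hsum _ (by omega)).tsum_add (hsum i hi.le)]
    rfl

/-! The identity between the continuations. -/

theorem starCoord_injective (k ℓ : ℕ) (i : Fin (k + 1)) :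
    Function.Injective (ribEquiv k ℓ ∘ splitEquiv k ℓ i ∘ Sum.inl) :=
  (ribEquiv k ℓ).injective.comp ((splitEquiv k ℓ i).injective.comp Sum.inl_injective)

theorem ezCoord_injective (k ℓ : ℕ) (i : Fin (k + 1)) :
    Function.Injective (ribEquiv k ℓ ∘ splitEquiv k ℓ i ∘ Sum.inr) :=
  (ribEquiv k ℓ).injective.comp ((splitEquiv k ℓ i).injective.comp Sum.inr_injective)

theorem meromorphicEqAt_rib {k ℓ : ℕ} {Z : (rib k ℓ → ℂ) → ℂ} {A B : ∀ r : ℕ, (Fin r → ℂ) → ℂ}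
    (hZ : IsContinuation (schurTerm (rib k ℓ)) (schurDomain (rib k ℓ)) Z)
    (hA : ∀ r, IsContinuation (ezStarTerm r) (ezDomain r) (A r))
    (hB : ∀ r, IsContinuation (ezTerm r) (ezDomain r) (B r)) (p : rib k ℓ → ℂ) :
    MeromorphicEqAt Z (fun s => ∑ i : Fin (k + 1), (-1 : ℂ) ^ (k - (i : ℕ)) *
      A i (starArgs k ℓ i s) * B (ℓ + k - i + 1) (ezArgs k ℓ i s)) p := by
  -- Near the constant point 2 all real parts exceed 1, so the identity of series applies there.
  refine meromorphicEqAt_of_eventuallyEq hZ.meromorphic (fun p => ?_) (p₀ := fun _ => 2) ?_ p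
  · refine IsMeromorphicAt.sum _ fun i _ => ?_
    refine IsMeromorphicAt.mul (IsMeromorphicAt.mul
      (AnalyticAt.isMeromorphicAt analyticAt_const) ?_) ?_
    · simp only [starArgs_eq]
      exact ((hA i).meromorphic _).comp_coord (starCoord_injective k ℓ i)
    · simp only [ezArgs_eq]
      exact ((hB _).meromorphic _).comp_coord (ezCoord_injective k ℓ i)
  · have hev : ∀ᶠ s : rib k ℓ → ℂ in 𝓝 (fun _ => 2), ∀ a, 1 < (s a).re :=
      Filter.eventually_all.2 fun a =>
        (Complex.continuous_re.comp (continuous_apply a)).continuousAt.eventually_const_lt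
          (by norm_num)
    filter_upwards [hev] with s hs
    rw [hZ.eq_tsum s fun a => ⟨(hs a).le, fun _ => hs a⟩]
    refine (zetaSchur_rib_eq hs).trans (Finset.sum_congr rfl fun i _ => ?_)
    rw [(hA i).eq_tsum _ (mem_ezDomain_of_one_lt fun a => by
        rw [starArgs_eq]
        exact hs _),
      (hB _).eq_tsum _ (mem_ezDomain_of_one_lt fun a => by
        rw [ezArgs_eq]
        exact hs _)]
    rfl

theorem analyticAt_rib_sum {k ℓ : ℕ} {A B : ∀ r : ℕ, (Fin r → ℂ) → ℂ} {s : rib k ℓ → ℂ}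
    (hA : ∀ i : Fin (k + 1), AnalyticAt ℂ (A i) (starArgs k ℓ i s))
    (hB : ∀ i : Fin (k + 1), AnalyticAt ℂ (B (ℓ + k - i + 1)) (ezArgs k ℓ i s)) :
    AnalyticAt ℂ (fun s => ∑ i : Fin (k + 1), (-1 : ℂ) ^ (k - (i : ℕ)) *
      A i (starArgs k ℓ i s) * B (ℓ + k - i + 1) (ezArgs k ℓ i s)) s := by
  refine Finset.analyticAt_fun_sum _ fun i _ => ?_
  refine AnalyticAt.mul (analyticAt_const.mul ?_) ?_
  · have h := hA i
    simp only [starArgs_eq] at h ⊢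
    exact AnalyticAt.comp_coord h
  · have h := hB i
    simp only [ezArgs_eq] at h ⊢
    exact AnalyticAt.comp_coord h

end SchurZeta

end

theorem mainTheorem1 (k ℓ : ℕ) (hk : 1 ≤ k) (hℓ : 1 ≤ ℓ) :
    -- the series of the anti-hook and all Euler-Zagier and star series have continuations
    (∃ Z : (SchurZeta.rib k ℓ → ℂ) → ℂ,
      SchurZeta.IsContinuation (SchurZeta.schurTerm (SchurZeta.rib k ℓ))
        (SchurZeta.schurDomain (SchurZeta.rib k ℓ)) Z) ∧
    (∀ r : ℕ, ∃ A : (Fin r → ℂ) → ℂ,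
      SchurZeta.IsContinuation (SchurZeta.ezStarTerm r) (SchurZeta.ezDomain r) A) ∧
    (∀ r : ℕ, ∃ B : (Fin r → ℂ) → ℂ,
      SchurZeta.IsContinuation (SchurZeta.ezTerm r) (SchurZeta.ezDomain r) B) ∧
    -- the identity between the series, where all real parts exceed one
    (∀ s : SchurZeta.rib k ℓ → ℂ, (∀ a, 1 < (s a).re) →
      SchurZeta.zetaSchur (SchurZeta.rib k ℓ) s =
        ∑ i : Fin (k + 1), (-1 : ℂ) ^ (k - (i : ℕ)) *
          SchurZeta.zetaEZStar i (SchurZeta.starArgs k ℓ i s) *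
          SchurZeta.zetaEZ (ℓ + k - i + 1) (SchurZeta.ezArgs k ℓ i s)) ∧
    -- the identity between the continuations, as meromorphic functions on the whole space, and
    -- pointwise wherever all functions in it are holomorphic
    (∀ (Z : (SchurZeta.rib k ℓ → ℂ) → ℂ) (A B : ∀ r : ℕ, (Fin r → ℂ) → ℂ),
      SchurZeta.IsContinuation (SchurZeta.schurTerm (SchurZeta.rib k ℓ))
        (SchurZeta.schurDomain (SchurZeta.rib k ℓ)) Z →
      (∀ r, SchurZeta.IsContinuation (SchurZeta.ezStarTerm r) (SchurZeta.ezDomain r) (A r)) →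
      (∀ r, SchurZeta.IsContinuation (SchurZeta.ezTerm r) (SchurZeta.ezDomain r) (B r)) →
      (∀ p : SchurZeta.rib k ℓ → ℂ, SchurZeta.MeromorphicEqAt Z
        (fun s => ∑ i : Fin (k + 1), (-1 : ℂ) ^ (k - (i : ℕ)) *
          A i (SchurZeta.starArgs k ℓ i s) *
          B (ℓ + k - i + 1) (SchurZeta.ezArgs k ℓ i s)) p) ∧
      (∀ s : SchurZeta.rib k ℓ → ℂ,
        AnalyticAt ℂ Z s →
        (∀ i : Fin (k + 1), AnalyticAt ℂ (A i) (SchurZeta.starArgs k ℓ i s)) →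
        (∀ i : Fin (k + 1),
          AnalyticAt ℂ (B (ℓ + k - i + 1)) (SchurZeta.ezArgs k ℓ i s)) →
        Z s = ∑ i : Fin (k + 1), (-1 : ℂ) ^ (k - (i : ℕ)) *
          A i (SchurZeta.starArgs k ℓ i s) *
          B (ℓ + k - i + 1) (SchurZeta.ezArgs k ℓ i s))) := by
  refine ⟨SchurZeta.exists_isContinuation_rib k ℓ, SchurZeta.exists_isContinuation_ezStarTerm,
    SchurZeta.exists_isContinuation_ezTerm, fun s hs => SchurZeta.zetaSchur_rib_eq hs,
    fun Z A B hZ hA hB => ?_⟩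
  have hmain := SchurZeta.meromorphicEqAt_rib hZ hA hB
  exact ⟨hmain, fun s hZs hAs hBs => (hmain s).eq_of_continuousAt hZs.continuousAt
    (SchurZeta.analyticAt_rib_sum hAs hBs).continuousAt⟩
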